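/- Conventions. For a probability distribution $F$ on $\mathbb{R}$ write $F(t)$ for its distribution function, $\overline F = 1-F$ for its tail, $h = F'/\overline F$ for its hazard rate and $\mu_{F,i}=\int x^i\,dF(x)$ for its $i$-th moment. A function $g$, ultimately positive or ultimately negative, is regularly varying of index $\rho$ if $\lim_{t\to\infty} g(ct)/g(t)=c^\rho$ for every $c>0$; it is smoothly varying of index $\rho$ and order $m$ if it is ultimately $m$ times continuously differentiable and its $m$-th derivative is regularly varying of index $\rho-m$. Let $\mathrm{D}$ be the derivation operator. If $F$ has $m$ moments, its Laplace character of order $m$ is the differential operator $\mathsf{L}_{F,m}=\sum_{0\le i\le m}\frac{(-1)^i}{i!}\mu_{F,i}\mathrm{D}^i$, viewed, for algebraic operations, as an element of the quotient ring $\mathbb{R}_m[\mathrm{D}]=\mathbb{R}[\mathrm{D}]/(\mathrm{D}^{m+1})$, whose unit is denoted $\mathrm{Id}$. Proposition. Let $m\ge 1$ be an integer and let $F$ be a probability distribution on $[0,\infty)$ whose hazard rate $h$ is smoothly varying of order $m$ and of some index $\rho\in[-1,0)$, with $$\lim_{t\to\infty}h(t)=0\qquad\text{and}\qquad \liminf_{t\to\infty}\frac{t\,h(t)}{\log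 t}>0 .$$ Let $X_1,X_2,\dots$ be independent random variables with distribution $F$, let $N$ be a Poisson random variable with parameter $a\ge 0$, independent of the sequence $(X_i)$, and let $G$ be the distribution of the compound sum $S_N=X_1+\cdots+X_N$ (with $S_0=0$). Then $F$ and $G$ have finite moments up to order $m$ and, as $t\to\infty$, $$\overline G = a\,\mathsf{L}_{G,m}\overline F + o(h^m\overline F).$$ Moreover, in $\mathbb{R}_m[\mathrm{D}]$ the element $a(\mathsf{L}_{F,m}-\mathrm{Id})$ is nilpotent and $$\mathsf{L}_{G,m}=\exp\bigl(a(\mathsf{L}_{F,m}-\mathrm{Id})\bigr),\qquad\text{where } \exp(x)=\sum_{n\ge 0}x^n/n! .$$ -/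

import Mathlib

open MeasureTheory ProbabilityTheory Filter Topology Asymptotics Polynomial
open scoped NNReal

namespace CompoundSum

noncomputable section

/-- `g` is regularly varying at infinity with index `ρ`. As is usual for derivatives of regularly
varying functions, `g` is allowed to be ultimately negative (i.e. `-g` is then regularly varying
in the sense of positive functions). -/
def IsRegularlyVarying (g : ℝ → ℝ) (ρ : ℝ) : Prop :=
  Measurable g ∧ ((∀ᶠ t in atTop, 0 < g t) ∨ (∀ᶠ t in atTop, g t < 0)) ∧
    ∀ c : ℝ, 0 < c → Tendsto (fun t => g (c * t) / g t) atTop (𝓝 (c ^ ρ))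

/-- `g` is smoothly varying of index `ρ` and order `m`: it is ultimately `m` times continuously
differentiable and its `m`-th derivative is regularly varying of index `ρ - m`. -/
def IsSmoothlyVarying (g : ℝ → ℝ) (ρ : ℝ) (m : ℕ) : Prop :=
  (∃ t₀ : ℝ, ContDiffOn ℝ m g (Set.Ioi t₀)) ∧ IsRegularlyVarying (iteratedDeriv m g) (ρ - m)

/-- The tail `1 - F` of the distribution function of `F`. -/
def tail (F : Measure ℝ) (t : ℝ) : ℝ := 1 - cdf F t

/-- The hazard rate `F' / (1 - F)`. -/
def hazardRate (F : Measure ℝ) (t : ℝ) : ℝ := deriv (cdf F) t / tail F t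

/-- The `F`-distribution has at least `m` moments. -/
def HasMoments (F : Measure ℝ) (m : ℕ) : Prop := ∀ i ≤ m, Integrable (fun x : ℝ => x ^ i) F

/-- The Laplace character `∑_{0 ≤ i ≤ m} ((-1)^i / i!) μ_{F,i} D^i` of order `m`, as a polynomial
in the indeterminate `D`. -/
def laplaceCharacter (F : Measure ℝ) (m : ℕ) : ℝ[X] :=
  ∑ i ∈ Finset.range (m + 1), C ((-1) ^ i / (i.factorial : ℝ) * moment id i F) * X ^ i

/-- The action on functions of a polynomial in the derivation `D`. -/
def applyDiffOp (p : ℝ[X]) (g : ℝ → ℝ) (t : ℝ) : ℝ :=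
  ∑ i ∈ Finset.range (p.natDegree + 1), p.coeff i * iteratedDeriv i g t

/-- The quotient ring `ℝ_m[D]` of polynomials in `D` modulo the ideal generated by `D^(m+1)`. -/
abbrev TruncatedRing (m : ℕ) : Type := ℝ[X] ⧸ Ideal.span {(X : ℝ[X]) ^ (m + 1)}

/-- The class in `ℝ_m[D]` of a polynomial in `D`. -/
abbrev toTruncatedRing (m : ℕ) (p : ℝ[X]) : TruncatedRing m := Ideal.Quotient.mk _ p

/-- The compound sum `S_N = X_1 + ⋯ + X_N` (with `S_0 = 0`); the sequence is indexed from `0`. -/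
def compoundSum {Ω : Type*} (N : Ω → ℕ) (X : ℕ → Ω → ℝ) (ω : Ω) : ℝ :=
  ∑ i ∈ Finset.range (N ω), X i ω

end

end CompoundSum

open CompoundSum

/-! Write `T` for the tail of `F` and `h` for its hazard rate. If independent summands satisfy `x +
y > t`, then either both exceed `t / 2` or exactly one does. So `tail_conv` writes the tail of a
convolution as two half-convolutions plus a product of tails at `t / 2`. Taylor expanding `T (t -
x)` to order `m` and integrating against `H` gives `L_H T` up to `O(h^(m+1) T)`, and the product has
that same order. Laplace characters multiply under convolution modulo `D^(m+1)`, so by induction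
(`abs_tail_conv_sub_le`) the tail of `F^{*(n+1)}` is `(n+1) L_{F^{*n}} T` up to an error `c^(n+1)
h^(m+1) T`, with `c` free of `n` and `t`. Poisson weights satisfy `(n+1) p_{n+1} = a p_n` and absorb
geometric growth, so averaging gives `a L_G T + O(h^(m+1) T)`. This is `o(h^m T)` because `h → 0`.

The analytic input is `exists_tailControl`. Smooth variation yields that `h` decreases, that `h (2t)
≤ q h t` with `q < 1`, and that `h^(j) = O(h / t^j)`. The liminf condition gives `t h t → ∞`, so
`h^(j) = O(h^(j+1))`, hence `T^(i) = O(h^i T)`, and `T` decays faster than any power. Errors are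
measured with the weight `W = T^(-(1+q)/2)`: it is submultiplicative up to a constant, dominates
powers, and is `F`-integrable because its exponent is above `-1`. So its integral against `F^{*n}`
grows at most geometrically.

For the exponential formula, `L_{F^{*n}} = L_F^n` is expanded binomially in the nilpotent `L_F - 1`,
and the Poisson average of `n.choose k` is `a^k / k!` (`laplaceCharacter_compoundPoisson`). -/

namespace CompoundSum

/-! ### Regular variation: uniform comparison on dyadic scales -/

/-- If all increments `k (x + u) - k x` of a continuous function converge as `x → ∞`, then they are
bounded uniformly in `u ∈ [0, 1]` and `x` large. -/
lemma exists_bound_increment {k : ℝ → ℝ} (hk : Continuous k) {l : ℝ → ℝ}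
    (hlim : ∀ u, Tendsto (fun x => k (x + u) - k x) atTop (𝓝 (l u))) :
    ∃ C, ∀ᶠ x in atTop, ∀ u ∈ Set.Icc (0 : ℝ) 1, |k (x + u) - k x| ≤ C := by
  let A : ℕ → Set ℝ := fun n => {u | ∀ x, (n : ℝ) ≤ x → |k (x + u) - k x| ≤ n}
  have hA : ∀ n, IsClosed (A n) := by
    intro n
    have : A n = ⋂ (x : ℝ) (_ : (n : ℝ) ≤ x), {u | |k (x + u) - k x| ≤ n} := by
      ext u; simp [A]
    rw [this]
    refine isClosed_iInter fun x => isClosed_iInter fun _ => ?_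
    exact isClosed_le (by fun_prop) continuous_const
  have hU : ⋃ n, A n = Set.univ := by
    refine Set.eq_univ_of_forall fun u => ?_
    have h1 : ∀ᶠ x in atTop, |k (x + u) - k x| < |l u| + 1 :=
      (hlim u).abs.eventually_lt_const (by linarith)
    obtain ⟨x₀, hx₀⟩ := eventually_atTop.1 h1
    obtain ⟨n, hn⟩ := exists_nat_ge (max x₀ (|l u| + 1))
    refine Set.mem_iUnion.2 ⟨n, fun x hx => ?_⟩
    have := hx₀ x (le_trans (le_trans (le_max_left _ _) hn) hx)
    exact this.le.trans ((le_max_right _ _).trans hn)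
  -- Baire: one of the closed sets `A n` covering the line contains a ball.
  obtain ⟨n, a, ha⟩ := nonempty_interior_of_iUnion_of_closed hA hU
  obtain ⟨r, hr, hball⟩ := Metric.isOpen_iff.1 isOpen_interior a ha
  have hmem : ∀ w, |w| < r → a + w ∈ A n := fun w hw =>
    interior_subset (hball (by simpa [Metric.mem_ball, Real.dist_eq] using hw))
  -- The increment by `w` at `y` is the difference of the increments by `a + w` and by `a` at `y -
  -- a`, whence the bound `2 * n`.
  have hstep : ∀ y, n + |a| ≤ y → ∀ w, |w| < r → |k (y + w) - k y| ≤ 2 * n := by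
    intro y hy w hw
    have h0 : (n : ℝ) ≤ y - a := by linarith [le_abs_self a]
    have h1 := hmem w hw (y - a) h0
    have h2 := hmem 0 (by simpa using hr) (y - a) h0
    rw [show y - a + (a + w) = y + w by ring] at h1
    rw [show y - a + (a + 0) = y by ring] at h2
    rw [abs_le] at *
    constructor <;> linarith [h1.1, h1.2, h2.1, h2.2]
  have hchain : ∀ (j : ℕ) (y w : ℝ), n + |a| ≤ y → 0 ≤ w → w < r →
      |k (y + j * w) - k y| ≤ j * (2 * n) := by
    intro j y w hy hw hwr
    induction j with
    | zero => simp
    | succ j ih =>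
      have h1 := hstep (y + j * w) (by nlinarith [(Nat.cast_nonneg j : (0:ℝ) ≤ j)]) w
        (by rwa [abs_of_nonneg hw])
      rw [show y + ((j + 1 : ℕ) : ℝ) * w = y + j * w + w by push_cast; ring]
      push_cast
      rw [abs_le] at *
      constructor <;> linarith [h1.1, h1.2, ih.1, ih.2]
  obtain ⟨j, hj⟩ := exists_nat_gt (1 / r)
  have hj0 : (0 : ℝ) < j := lt_trans (by positivity) hj
  refine ⟨j * (2 * n), eventually_atTop.2 ⟨n + |a|, fun x hx u hu => ?_⟩⟩
  have := hchain j x (u / j) hx (div_nonneg hu.1 hj0.le) (by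
    rw [div_lt_iff₀ hj0]
    have : 1 < j * r := by rwa [div_lt_iff₀ hr] at hj
    linarith [hu.2])
  rwa [mul_div_cancel₀ _ hj0.ne'] at this

/-- A positive function `u` decaying at least by the factor `r` and at most by a constant factor
when its argument is doubled, eventually. -/
def DoublingDecay (u : ℝ → ℝ) (r : ℝ) : Prop :=
  ∃ C : ℝ, ∀ᶠ t in atTop, 0 < u t ∧ u (2 * t) ≤ r * u t ∧
    ∀ c ∈ Set.Icc (1 : ℝ) 2, u t ≤ C * u (c * t)

/-- In the logarithmic variable, ratios of `g` become increments of `log ∘ g ∘ exp`, so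
`exists_bound_increment` gives a bound uniform in `c ∈ [1, 2]`. The factor `r` only needs the limit
at `c = 2`. -/
lemma doublingDecay_of_tendsto {g : ℝ → ℝ} {ρ r t₀ : ℝ} (hcont : ContinuousOn g (Set.Ioi t₀))
    (hpos : ∀ᶠ t in atTop, 0 < g t)
    (hlim : ∀ c : ℝ, 0 < c → Tendsto (fun t => g (c * t) / g t) atTop (𝓝 (c ^ ρ)))
    (hr : (2 : ℝ) ^ ρ < r) : DoublingDecay g r := by
  obtain ⟨t₁, ht₁⟩ := eventually_atTop.1 hpos
  set t₂ := max (max t₁ (t₀ + 1)) 1 with ht₂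
  have h21 : t₁ ≤ t₂ := (le_max_left _ _).trans (le_max_left _ _)
  have h20 : t₀ < t₂ := by
    have : t₀ + 1 ≤ t₂ := (le_max_right _ _).trans (le_max_left _ _)
    linarith
  have h2p : 1 ≤ t₂ := le_max_right _ _
  -- Truncating at `t₂` makes `k` continuous on the whole line without changing it near infinity.
  let k : ℝ → ℝ := fun x => Real.log (g (max (Real.exp x) t₂))
  have hk : Continuous k := by
    have h1 : Continuous fun x : ℝ => g (max (Real.exp x) t₂) :=
      hcont.comp_continuous (by fun_prop) fun x => lt_of_lt_of_le h20 (le_max_right _ _)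
    exact h1.log fun x => (ht₁ _ (h21.trans (le_max_right _ _))).ne'
  have hkx : ∀ t, t₂ ≤ t → k (Real.log t) = Real.log (g t) := by
    intro t ht
    simp only [k]
    rw [Real.exp_log (by linarith), max_eq_left ht]
  have hklim : ∀ u, Tendsto (fun x => k (x + u) - k x) atTop (𝓝 (Real.log (Real.exp u ^ ρ))) := by
    intro u
    have h1 := ((hlim (Real.exp u) (Real.exp_pos u)).comp Real.tendsto_exp_atTop).log
      (Real.rpow_pos_of_pos (Real.exp_pos u) ρ).ne'
    refine h1.congr' ?_
    have e1 : ∀ᶠ x : ℝ in atTop, t₂ ≤ Real.exp x :=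
      Real.tendsto_exp_atTop.eventually_ge_atTop t₂
    have e2 : ∀ᶠ x : ℝ in atTop, t₂ ≤ Real.exp (x + u) :=
      (Real.tendsto_exp_atTop.comp (tendsto_atTop_add_const_right _ u tendsto_id)).eventually_ge_atTop
        t₂
    filter_upwards [e1, e2] with x hx hxu
    have hg1 := ht₁ _ (h21.trans hx)
    have hg2 := ht₁ _ (h21.trans hxu)
    simp only [Function.comp, k]
    rw [max_eq_left hx, max_eq_left hxu, ← Real.exp_add, add_comm u x,
      Real.log_div hg2.ne' hg1.ne']
  obtain ⟨C, hC⟩ := exists_bound_increment hk hklim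
  refine ⟨Real.exp C, ?_⟩
  filter_upwards [Real.tendsto_log_atTop.eventually hC, eventually_ge_atTop t₂,
    (hlim 2 two_pos).eventually_lt_const hr] with t h1 h2 h3
  have hgt := ht₁ t (h21.trans h2)
  refine ⟨hgt, ?_, fun c hc => ?_⟩
  · rw [div_lt_iff₀ hgt] at h3
    exact h3.le
  · have hc0 : 0 < c := by linarith [hc.1]
    have ht0 : 0 < t := by linarith
    have hct : t₂ ≤ c * t := by nlinarith [hc.1]
    have h4 := h1 (Real.log c) ⟨Real.log_nonneg hc.1, by
      have := Real.log_le_log hc0 hc.2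
      linarith [Real.log_two_lt_d9]⟩
    rw [← Real.log_mul ht0.ne' hc0.ne', mul_comm t c, hkx _ hct, hkx _ h2, abs_le] at h4
    have hgc := ht₁ _ (h21.trans hct)
    have : Real.log (g t) ≤ C + Real.log (g (c * t)) := by linarith [h4.1]
    calc g t = Real.exp (Real.log (g t)) := (Real.exp_log hgt).symm
      _ ≤ Real.exp (C + Real.log (g (c * t))) := Real.exp_le_exp.2 this
      _ = _ := by rw [Real.exp_add, Real.exp_log hgc]

/-! ### Smooth variation: from the top derivative down to the function -/

lemma antitoneOn_Ici_of_hasDerivAt_nonpos {f f' : ℝ → ℝ} {t₁ : ℝ}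
    (hf : ∀ t, t₁ ≤ t → HasDerivAt f (f' t) t) (hf' : ∀ t, t₁ ≤ t → f' t ≤ 0) :
    AntitoneOn f (Set.Ici t₁) := by
  refine antitoneOn_of_deriv_nonpos (convex_Ici _)
    (fun t ht => (hf t ht).continuousAt.continuousWithinAt)
    (fun t ht => ?_) fun t ht => ?_
  · exact (hf t (interior_subset ht)).differentiableAt.differentiableWithinAt
  · rw [(hf t (interior_subset ht)).deriv]
    exact hf' t (interior_subset ht)

lemma strictAntiOn_Ici_of_hasDerivAt_neg {f f' : ℝ → ℝ} {t₁ : ℝ}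
    (hf : ∀ t, t₁ ≤ t → HasDerivAt f (f' t) t) (hf' : ∀ t, t₁ ≤ t → f' t < 0) :
    StrictAntiOn f (Set.Ici t₁) := by
  refine strictAntiOn_of_deriv_neg (convex_Ici _)
    (fun t ht => (hf t ht).continuousAt.continuousWithinAt) fun t ht => ?_
  rw [(hf t (interior_subset ht)).deriv]
  exact hf' t (interior_subset ht)

lemma nonneg_of_antitoneOn_of_tendsto_zero {f : ℝ → ℝ} {t₁ t : ℝ}
    (hf : AntitoneOn f (Set.Ici t₁)) (h0 : Tendsto f atTop (𝓝 0)) (ht : t₁ ≤ t) : 0 ≤ f t := by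
  refine le_of_tendsto h0 ?_
  filter_upwards [eventually_ge_atTop t] with s hs
  exact hf ht (ht.trans hs) hs

/-- Passing from a decaying function `u` to its primitive `v` vanishing at infinity. -/
lemma DoublingDecay.primitive {u v : ℝ → ℝ} {r : ℝ} (hu : DoublingDecay u r)
    (hv : ∀ᶠ t in atTop, HasDerivAt v (-u t) t) (h0 : Tendsto v atTop (𝓝 0)) :
    DoublingDecay v (2 * r) ∧ ∃ C : ℝ, ∀ᶠ t in atTop, u t ≤ C * (v t / t) := by
  obtain ⟨C, hC⟩ := hu
  obtain ⟨t₁, h1⟩ := eventually_atTop.1 ((hC.and hv).and (eventually_gt_atTop 0))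
  have hpos : 0 < t₁ := (h1 t₁ le_rfl).2
  have hd : ∀ t, t₁ ≤ t → HasDerivAt v (-u t) t := fun t ht => (h1 t ht).1.2
  have hu0 : ∀ t, t₁ ≤ t → 0 < u t := fun t ht => (h1 t ht).1.1.1
  have hd2 : ∀ t, t₁ ≤ t → HasDerivAt (fun t => v (2 * t)) (-(2 * u (2 * t))) t := by
    intro t ht
    have := HasDerivAt.comp t (hd (2 * t) (by linarith)) ((hasDerivAt_id' t).const_mul 2)
    exact this.congr_deriv (by ring)
  have h02 : Tendsto (fun t => v (2 * t)) atTop (𝓝 0) :=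
    h0.comp (tendsto_id.const_mul_atTop two_pos)
  have hanti := strictAntiOn_Ici_of_hasDerivAt_neg hd fun t ht => by linarith [hu0 t ht]
  have hvpos : ∀ t, t₁ ≤ t → 0 < v t := fun t ht => by
    have a1 := nonneg_of_antitoneOn_of_tendsto_zero hanti.antitoneOn h0
      (show t₁ ≤ t + 1 by linarith)
    have a2 := hanti ht (show t₁ ≤ t + 1 by linarith) (by linarith : t < t + 1)
    linarith
  -- The difference has derivative `2 (u (2 s) - r u s) ≤ 0` and vanishes at infinity, so it is
  -- nonnegative.
  have hdouble : ∀ t, t₁ ≤ t → v (2 * t) ≤ 2 * r * v t := fun t ht => by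
    have : AntitoneOn (fun t => 2 * r * v t - v (2 * t)) (Set.Ici t₁) :=
      antitoneOn_Ici_of_hasDerivAt_nonpos
        (fun s hs => ((hd s hs).const_mul (2 * r)).sub (hd2 s hs))
        fun s hs => by nlinarith [(h1 s hs).1.1.2.1]
    have := nonneg_of_antitoneOn_of_tendsto_zero this
      (by simpa using (h0.const_mul (2 * r)).sub h02) ht
    linarith
  have hC0 : 0 < C := by
    have a1 := (h1 t₁ le_rfl).1.1.2.2 1 ⟨le_rfl, one_le_two⟩
    have a2 := hu0 t₁ le_rfl
    rw [one_mul] at a1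
    by_contra hneg
    nlinarith
  have hlow : ∀ t, t₁ ≤ t → v t ≤ C / 2 * v (2 * t) := fun t ht => by
    have : AntitoneOn (fun t => C / 2 * v (2 * t) - v t) (Set.Ici t₁) :=
      antitoneOn_Ici_of_hasDerivAt_nonpos
        (fun s hs => ((hd2 s hs).const_mul (C / 2)).sub (hd s hs))
        fun s hs => by nlinarith [(h1 s hs).1.1.2.2 2 ⟨one_le_two, le_rfl⟩]
    have := nonneg_of_antitoneOn_of_tendsto_zero this
      (by simpa using (h02.const_mul (C / 2)).sub h0) ht
    linarith
  refine ⟨⟨C / 2, eventually_atTop.2 ⟨t₁, fun t ht => ⟨hvpos t ht, hdouble t ht, ?_⟩⟩⟩,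
    C, eventually_atTop.2 ⟨t₁, fun t ht => ?_⟩⟩
  · intro c hc
    have ht0 : 0 < t := by linarith
    have h2 : v (2 * t) ≤ v (c * t) := hanti.antitoneOn
      (show t₁ ≤ c * t by nlinarith [hc.1]) (show t₁ ≤ 2 * t by linarith) (by nlinarith [hc.2])
    refine (hlow t ht).trans ?_
    gcongr
  · have ht0 : 0 < t := by linarith
    -- By the mean value theorem on `[t, 2 t]`, `u ξ = (v t - v (2 t)) / t ≤ v t / t`, and `u t ≤ C
    -- * u ξ`.
    obtain ⟨ξ, hξ, hξe⟩ := exists_hasDerivAt_eq_slope v (fun s => -u s)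
      (show t < 2 * t by linarith)
      (fun s hs => (hd s (ht.trans hs.1)).continuousAt.continuousWithinAt)
      fun s hs => hd s (ht.trans hs.1.le)
    have h2 := (h1 t ht).1.1.2.2 (ξ / t) ⟨by rw [le_div_iff₀ ht0]; linarith [hξ.1],
      by rw [div_le_iff₀ ht0]; linarith [hξ.2]⟩
    rw [div_mul_cancel₀ _ ht0.ne'] at h2
    have h3 : u ξ ≤ v t / t := by
      rw [eq_div_iff (by linarith)] at hξe
      rw [le_div_iff₀ ht0]
      nlinarith [hvpos (2 * t) (by linarith)]
    exact h2.trans (mul_le_mul_of_nonneg_left h3 hC0.le)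

/-- A function with an iterated derivative bounded below by a positive constant does not vanish at
infinity. -/
lemma not_tendsto_zero_of_iterated_deriv_ge {H : ℕ → ℝ → ℝ} {j : ℕ}
    (hH : ∀ i < j, ∀ᶠ t in atTop, HasDerivAt (H i) (H (i + 1) t) t) {c : ℝ} (hc : 0 < c)
    (hge : ∀ᶠ t in atTop, c ≤ H j t) : ¬ Tendsto (H 0) atTop (𝓝 0) := by
  induction j generalizing c with
  | zero =>
    intro h0
    exact hc.not_ge (ge_of_tendsto h0 hge)
  | succ j ih =>
    obtain ⟨t₁, h1⟩ := eventually_atTop.1 ((hH j (Nat.lt_succ_self j)).and hge)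
    -- A derivative bounded below by `c > 0` forces linear growth, so the previous function
    -- eventually exceeds 1.
    refine ih (fun i hi => hH i (by omega)) one_pos ?_
    have hanti : AntitoneOn (fun t => c * t - H j t) (Set.Ici t₁) :=
      antitoneOn_Ici_of_hasDerivAt_nonpos
        (fun s hs => ((hasDerivAt_id s).const_mul c).sub (h1 s hs).1)
        fun s hs => by linarith [(h1 s hs).2]
    filter_upwards [eventually_ge_atTop t₁,
      (tendsto_id.const_mul_atTop hc).eventually_ge_atTop (1 + (c * t₁ - H j t₁))] with t ht ht2
    have := hanti (Set.self_mem_Ici) ht ht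
    simp only [id] at ht2 this
    linarith

/-- `H j` is eventually decreasing, so it has a limit, possibly `-∞`. A nonzero limit would keep `H
j` or `-H j` above a positive constant, which `not_tendsto_zero_of_iterated_deriv_ge` excludes. -/
lemma tendsto_zero_of_deriv_neg {H : ℕ → ℝ → ℝ} {j : ℕ}
    (hH : ∀ i ≤ j, ∀ᶠ t in atTop, HasDerivAt (H i) (H (i + 1) t) t)
    (hneg : ∀ᶠ t in atTop, H (j + 1) t < 0) (h0 : Tendsto (H 0) atTop (𝓝 0)) :
    Tendsto (H j) atTop (𝓝 0) := by
  obtain ⟨t₁, h1⟩ := eventually_atTop.1 ((hH j le_rfl).and hneg)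
  have hanti : AntitoneOn (H j) (Set.Ici t₁) :=
    antitoneOn_Ici_of_hasDerivAt_nonpos (fun s hs => (h1 s hs).1) fun s hs => (h1 s hs).2.le
  have hupper : ∀ ε > 0, ∀ᶠ t in atTop, H j t < ε := by
    intro ε hε
    by_contra hcon
    rw [not_eventually] at hcon
    refine not_tendsto_zero_of_iterated_deriv_ge (fun i hi => hH i hi.le) hε ?_ h0
    filter_upwards [eventually_ge_atTop t₁] with t ht
    obtain ⟨s, hs, hs2⟩ := (hcon.and_eventually (eventually_ge_atTop t)).exists
    exact (not_lt.1 hs).trans (hanti ht (ht.trans hs2) hs2)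
  have hlower : ∀ ε > 0, ∀ᶠ t in atTop, -ε < H j t := by
    intro ε hε
    by_contra hcon
    rw [not_eventually] at hcon
    obtain ⟨s, hs, hs2⟩ := (hcon.and_eventually (eventually_ge_atTop t₁)).exists
    refine not_tendsto_zero_of_iterated_deriv_ge (H := fun i t => -H i t) (j := j)
      (fun i hi => (hH i hi.le).mono fun t ht => ht.neg) hε ?_ (by simpa using h0.neg)
    filter_upwards [eventually_ge_atTop s] with t ht
    have := hanti hs2 (le_trans hs2 ht) ht
    linarith [not_lt.1 hs]
  rw [Metric.tendsto_nhds]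
  intro ε hε
  filter_upwards [hupper ε hε, hlower ε hε] with t h2 h3
  rw [Real.dist_eq, sub_zero, abs_lt]
  exact ⟨h3, h2⟩

/-- Descending from the top derivative of a function vanishing at infinity. -/
lemma doublingDecay_descend {H : ℕ → ℝ → ℝ} {m : ℕ}
    (hH : ∀ i < m, ∀ᶠ t in atTop, HasDerivAt (H i) (H (i + 1) t) t)
    (h0 : Tendsto (H 0) atTop (𝓝 0)) {q ε : ℝ}
    (htop : DoublingDecay (fun t => ε * ((-1) ^ m * H m t)) (q / 2 ^ m)) {j : ℕ} (hj : j ≤ m) :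
    DoublingDecay (fun t => ε * ((-1) ^ j * H j t)) (q / 2 ^ j) ∧
    (j < m → ∃ C : ℝ, ∀ᶠ t in atTop,
      ε * ((-1) ^ (j + 1) * H (j + 1) t) ≤ C * ((ε * ((-1) ^ j * H j t)) / t)) := by
  induction hj using Nat.decreasingInduction with
  | self => exact ⟨htop, fun h => absurd h (lt_irrefl _)⟩
  | of_succ j hj ih =>
    have hD := ih.1
    -- The sign `(-1) ^ j` is frozen while `i` varies, so that `H'` is still a chain of successive
    -- derivatives.
    set H' : ℕ → ℝ → ℝ := fun i t => ε * ((-1) ^ j * H i t) with hH'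
    have hd : ∀ i ≤ j, ∀ᶠ t in atTop, HasDerivAt (H' i) (H' (i + 1) t) t := fun i hi =>
      (hH i (by omega)).mono fun t ht => (ht.const_mul _).const_mul _
    have hz : Tendsto (H' j) atTop (𝓝 0) := by
      refine tendsto_zero_of_deriv_neg hd ?_ (by simpa using (h0.const_mul _).const_mul _)
      obtain ⟨C, hC⟩ := hD
      refine hC.mono fun t ht => ?_
      have := ht.1
      simp only [pow_succ] at this
      simp only [hH']
      linarith
    have := hD.primitive (v := H' j) ((hd j le_rfl).mono fun t ht => by
      convert ht using 1
      simp only [hH', pow_succ]; ring) hz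
    refine ⟨?_, fun _ => this.2⟩
    convert this.1 using 1
    rw [pow_succ]; field_simp

/-- Quantitative consequences of smooth variation with negative index for a positive function
vanishing at infinity. -/
lemma IsSmoothlyVarying.eventually_bounds {h : ℝ → ℝ} {ρ : ℝ} {m : ℕ} (hs : IsSmoothlyVarying h ρ m)
    (hm : 1 ≤ m) (hρ : ρ < 0) (h0 : Tendsto h atTop (𝓝 0)) (hpos : ∀ᶠ t in atTop, 0 < h t) :
    ∃ q K : ℝ, 0 < q ∧ q < 1 ∧ ∀ᶠ t in atTop, deriv h t < 0 ∧ h (2 * t) ≤ q * h t ∧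
      h t ≤ K * h (2 * t) ∧ ∀ j ≤ m, |iteratedDeriv j h t| ≤ K * (h t / t ^ j) := by
  obtain ⟨⟨t₀, hcd⟩, -, hsign, hlim⟩ := hs
  have hiter : ∀ i ≤ m, Set.EqOn (iteratedDerivWithin i h (Set.Ioi t₀)) (iteratedDeriv i h)
      (Set.Ioi t₀) := fun i _ => iteratedDerivWithin_of_isOpen isOpen_Ioi
  have hcont : ContinuousOn (iteratedDeriv m h) (Set.Ioi t₀) :=
    (hcd.continuousOn_iteratedDerivWithin le_rfl (uniqueDiffOn_Ioi t₀)).congr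
      (hiter m le_rfl).symm
  have hH : ∀ i < m, ∀ᶠ t in atTop,
      HasDerivAt (iteratedDeriv i h) (iteratedDeriv (i + 1) h t) t := by
    intro i hi
    filter_upwards [eventually_gt_atTop t₀] with t ht
    have h1 : DifferentiableOn ℝ (iteratedDerivWithin i h (Set.Ioi t₀)) (Set.Ioi t₀) :=
      hcd.differentiableOn_iteratedDerivWithin (by exact_mod_cast hi) (uniqueDiffOn_Ioi t₀)
    have h2 := (h1.congr (hiter i hi.le).symm).differentiableAt (Ioi_mem_nhds ht)
    rw [iteratedDeriv_succ]
    exact h2.hasDerivAt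
  have h2ρ : (2 : ℝ) ^ ρ < 1 := Real.rpow_lt_one_of_one_lt_of_neg one_lt_two hρ
  obtain ⟨q, hq1, hq2⟩ := exists_between h2ρ
  have hq0 : 0 < q := lt_trans (Real.rpow_pos_of_pos two_pos ρ) hq1
  -- Each integration doubles the decay factor, so starting from `q / 2 ^ m` leaves `q` for `h`
  -- itself.
  have hqm : (2 : ℝ) ^ (ρ - m) < q / 2 ^ m := by
    rw [Real.rpow_sub two_pos, Real.rpow_natCast]
    gcongr
  have hH0 : Tendsto (iteratedDeriv 0 h) atTop (𝓝 0) := by simpa using h0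
  -- The sign of the top derivative is not known beforehand. It is recorded by `ε`, and positivity
  -- of `h` at the end of the descent forces `ε = 1`.
  obtain ⟨ε, hε, htop⟩ : ∃ ε : ℝ, (ε = 1 ∨ ε = -1) ∧
      DoublingDecay (fun t => ε * ((-1) ^ m * iteratedDeriv m h t)) (q / 2 ^ m) := by
    rcases hsign with hsg | hsg
    · refine ⟨(-1) ^ m, neg_one_pow_eq_or ℝ m, ?_⟩
      simp only [← mul_assoc, ← mul_pow, neg_mul_neg, one_mul, one_pow]
      exact doublingDecay_of_tendsto hcont hsg hlim hqm
    · refine ⟨-(-1) ^ m, by rcases neg_one_pow_eq_or ℝ m with h | h <;> simp [h], ?_⟩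
      simp only [neg_mul, ← mul_assoc, ← mul_pow, neg_neg, one_mul, one_pow]
      refine doublingDecay_of_tendsto hcont.neg (hsg.mono fun t ht => by simpa using ht)
        (fun c hc => (hlim c hc).congr fun t => by simp [neg_div_neg_eq]) hqm
  have hdesc := fun {j : ℕ} => doublingDecay_descend hH hH0 htop (j := j)
  have hε1 : ε = 1 := by
    rcases hε with h | h
    · exact h
    · obtain ⟨C, hC⟩ := (hdesc (Nat.zero_le m)).1
      obtain ⟨t, ht, ht2⟩ := (hC.and hpos).exists
      have := ht.1
      rw [h] at this
      simp at this
      linarith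
  subst hε1
  simp only [one_mul] at hdesc
  obtain ⟨K₀, hK₀⟩ := (hdesc (Nat.zero_le m)).1
  have hbd : ∀ j ≤ m, ∃ K : ℝ, 0 ≤ K ∧ ∀ᶠ t in atTop, |iteratedDeriv j h t| ≤ K * (h t / t ^ j) := by
    intro j hj
    induction j with
    | zero =>
      refine ⟨1, zero_le_one, ?_⟩
      filter_upwards [hpos] with t ht
      simp [abs_of_pos ht]
    | succ j ih =>
      obtain ⟨K, hK, hKb⟩ := ih (by omega)
      obtain ⟨C, hC⟩ := (hdesc (show j ≤ m by omega)).2 (by omega)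
      obtain ⟨C', hC'⟩ := (hdesc (show j + 1 ≤ m by omega)).1
      refine ⟨|C| * K, by positivity, ?_⟩
      filter_upwards [hKb, hC, hC', eventually_gt_atTop 0] with t h1 h2 h3 h4
      have e1 : ∀ i, |(-1) ^ i * iteratedDeriv i h t| = |iteratedDeriv i h t| := fun i => by
        rw [abs_mul, abs_pow]; simp
      calc |iteratedDeriv (j + 1) h t| = (-1) ^ (j + 1) * iteratedDeriv (j + 1) h t := by
            rw [← e1, abs_of_pos h3.1]
        _ ≤ C * ((-1) ^ j * iteratedDeriv j h t / t) := h2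
        _ ≤ |C| * |(-1) ^ j * iteratedDeriv j h t / t| := by
            rw [← abs_mul]; exact le_abs_self _
        _ = |C| * (|iteratedDeriv j h t| / t) := by rw [abs_div, e1, abs_of_pos h4]
        _ ≤ |C| * (K * (h t / t ^ j) / t) := by gcongr
        _ = _ := by rw [pow_succ]; field_simp
  choose! K hKnn hK using hbd
  refine ⟨q, |K₀| + ∑ j ∈ Finset.range (m + 1), K j, hq0, hq2, ?_⟩
  have hall : ∀ᶠ t in atTop, ∀ j ∈ Finset.range (m + 1),
      |iteratedDeriv j h t| ≤ K j * (h t / t ^ j) := by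
    rw [Finset.eventually_all]
    exact fun j hj => hK j (Finset.mem_range_succ_iff.1 hj)
  have hsumnn : 0 ≤ ∑ j ∈ Finset.range (m + 1), K j :=
    Finset.sum_nonneg fun j hj => hKnn j (Finset.mem_range_succ_iff.1 hj)
  obtain ⟨C₁, hC₁⟩ := (hdesc hm).1
  filter_upwards [hK₀, hall, hC₁, hpos, eventually_gt_atTop 0,
    (tendsto_id.const_mul_atTop (two_pos (α := ℝ))).eventually hpos] with t h1 h2 h3 h4 h5 h6
  refine ⟨?_, ?_, ?_, fun j hj => ?_⟩
  · have := h3.1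
    simp [iteratedDeriv_one] at this
    exact this
  · simpa using h1.2.1
  · have h7 := h1.2.2 2 ⟨one_le_two, le_rfl⟩
    simp only [pow_zero, one_mul, iteratedDeriv_zero] at h7
    simp only [id] at h6
    refine h7.trans ?_
    gcongr
    linarith [le_abs_self K₀]
  · refine (h2 j (Finset.mem_range_succ_iff.2 hj)).trans ?_
    have : K j ≤ ∑ j ∈ Finset.range (m + 1), K j :=
      Finset.single_le_sum (f := K) (fun i hi => hKnn i (Finset.mem_range_succ_iff.1 hi))
        (Finset.mem_range_succ_iff.2 hj)
    have : 0 ≤ h t / t ^ j := by positivity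
    gcongr
    linarith [abs_nonneg K₀]

/-! ### Derivatives of the tail in terms of the hazard rate -/

/-- A positive survival function `T` with hazard rate `h` on `[t₁, ∞)`, together with the bounds on
`h` and on the derivatives of `T` that drive the asymptotic expansions. -/
structure TailControl (T h : ℝ → ℝ) (m : ℕ) (t₁ q K : ℝ) : Prop where
  antitone : Antitone T
  pos : ∀ t, 0 < T t
  le_one : ∀ t, T t ≤ 1
  one_le : 1 ≤ t₁
  q_pos : 0 < q
  q_lt_one : q < 1
  hazard_pos : ∀ t, t₁ ≤ t → 0 < h t
  hazard_le_one : ∀ t, t₁ ≤ t → h t ≤ 1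
  one_le_mul_hazard : ∀ t, t₁ ≤ t → 1 ≤ t * h t
  tendsto_mul_hazard : Tendsto (fun t => t * h t) atTop atTop
  hazard_antitone : AntitoneOn h (Set.Ici t₁)
  hazard_le_two_mul : ∀ t, t₁ ≤ t → h t ≤ K * h (2 * t)
  hazard_two_mul_le : ∀ t, t₁ ≤ t → h (2 * t) ≤ q * h t
  hasDerivAt : ∀ t, t₁ ≤ t → HasDerivAt T (-(h t * T t)) t
  hasDerivAt_iteratedDeriv : ∀ i ≤ m, ∀ t, t₁ ≤ t →
    HasDerivAt (iteratedDeriv i T) (iteratedDeriv (i + 1) T t) t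
  abs_iteratedDeriv_le : ∀ i ≤ m + 1, ∀ t, t₁ ≤ t → |iteratedDeriv i T t| ≤ K * (h t ^ i * T t)

lemma tail_antitone (F : Measure ℝ) : Antitone (tail F) := fun s t hst => by
  have := monotone_cdf F hst
  simp only [tail]; linarith

lemma tail_le_one (F : Measure ℝ) (t : ℝ) : tail F t ≤ 1 := by
  have := cdf_nonneg F t
  simp only [tail]; linarith

lemma tail_nonneg (F : Measure ℝ) (t : ℝ) : 0 ≤ tail F t := by
  have := cdf_le_one F t
  simp only [tail]; linarith

lemma tendsto_tail_atTop (F : Measure ℝ) : Tendsto (tail F) atTop (𝓝 0) := by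
  have := (tendsto_cdf_atTop F).const_sub 1
  rwa [sub_self] at this

lemma tail_eq_real (F : Measure ℝ) [IsProbabilityMeasure F] (t : ℝ) :
    tail F t = F.real (Set.Ioi t) := by
  rw [tail, cdf_eq_real, ← Set.compl_Iic, probReal_compl_eq_one_sub measurableSet_Iic]

lemma tail_pos_of_hazardRate_pos {F : Measure ℝ} {t : ℝ} (h : 0 < hazardRate F t) :
    0 < tail F t := by
  refine lt_of_le_of_ne (tail_nonneg F t) fun h0 => ?_
  simp [hazardRate, ← h0] at h

lemma hasDerivAt_tail_of_hazardRate_pos {F : Measure ℝ} {t : ℝ} (h : 0 < hazardRate F t) :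
    HasDerivAt (tail F) (-(hazardRate F t * tail F t)) t := by
  have hT := tail_pos_of_hazardRate_pos h
  have hd : deriv (cdf F) t ≠ 0 := fun h0 => by simp [hazardRate, h0] at h
  have := (differentiableAt_of_deriv_ne_zero hd).hasDerivAt.const_sub 1
  rw [hazardRate, div_mul_cancel₀ _ hT.ne']
  exact this

/-- A solution of `T' = -h T` is one order smoother than `h`. -/
lemma contDiffOn_of_hasDerivAt_mul {T h : ℝ → ℝ} {m : ℕ} {t₀ : ℝ}
    (hh : ContDiffOn ℝ m h (Set.Ioi t₀))
    (hT : ∀ t ∈ Set.Ioi t₀, HasDerivAt T (-(h t * T t)) t) {i : ℕ} (hi : i ≤ m + 1) :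
    ContDiffOn ℝ i T (Set.Ioi t₀) := by
  have hd : DifferentiableOn ℝ T (Set.Ioi t₀) := fun t ht =>
    (hT t ht).differentiableAt.differentiableWithinAt
  induction i with
  | zero => simpa using hd.continuousOn
  | succ i ih =>
    push_cast
    rw [contDiffOn_succ_iff_deriv_of_isOpen isOpen_Ioi]
    refine ⟨hd, by simp, ?_⟩
    have h1 : ContDiffOn ℝ i (fun t => -(h t * T t)) (Set.Ioi t₀) :=
      ((hh.of_le (by exact_mod_cast (by omega : i ≤ m))).mul (ih (by omega))).neg
    exact h1.congr fun t ht => (hT t ht).deriv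

/-- If `T' = -h T` and `h^{(j)} = O(h^{j+1})`, then `T^{(i)} = O(h^i T)`. -/
lemma exists_abs_iteratedDeriv_le {T h : ℝ → ℝ} {m : ℕ} {t₀ K : ℝ}
    (hh : ContDiffOn ℝ m h (Set.Ioi t₀))
    (hT : ∀ t ∈ Set.Ioi t₀, HasDerivAt T (-(h t * T t)) t)
    (hTpos : ∀ t ∈ Set.Ioi t₀, 0 ≤ T t) (hpos : ∀ t ∈ Set.Ioi t₀, 0 ≤ h t)
    (hK : ∀ j ≤ m, ∀ t ∈ Set.Ioi t₀, |iteratedDeriv j h t| ≤ K * h t ^ (j + 1)) {i : ℕ}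
    (hi : i ≤ m + 1) :
    ∃ C, 0 ≤ C ∧ ∀ t ∈ Set.Ioi t₀, |iteratedDeriv i T t| ≤ C * (h t ^ i * T t) := by
  induction i using Nat.strong_induction_on with
  | _ i ih =>
  rcases i with _ | i
  · exact ⟨1, zero_le_one, fun t ht => by simp [abs_of_nonneg (hTpos t ht)]⟩
  choose! C hC0 hC using ih
  -- These constants come from Leibniz's rule for `h * T`: every term carries `h^(j+1) * h^(i-j) =
  -- h^(i+1)`.
  refine ⟨∑ j ∈ Finset.range (i + 1), i.choose j * |K| * C (i - j), Finset.sum_nonneg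
    fun j hj => mul_nonneg (by positivity) (hC0 _ (by omega) (by omega)), fun t ht => ?_⟩
  have hnhds : Set.Ioi t₀ ∈ 𝓝 t := Ioi_mem_nhds ht
  have hder : iteratedDeriv (i + 1) T t = -iteratedDeriv i (h * T) t := by
    rw [iteratedDeriv_succ', ← iteratedDeriv_neg]
    refine Filter.EventuallyEq.iteratedDeriv_eq i ?_
    filter_upwards [hnhds] with s hs
    exact (hT s hs).deriv
  have him : i ≤ m := by omega
  rw [hder, abs_neg, iteratedDeriv_mul
    ((hh.of_le (by exact_mod_cast him)).contDiffAt hnhds)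
    ((contDiffOn_of_hasDerivAt_mul hh hT (by omega)).contDiffAt hnhds), Finset.sum_mul]
  refine (Finset.abs_sum_le_sum_abs _ _).trans (Finset.sum_le_sum fun j hj => ?_)
  have hji : j ≤ i := Finset.mem_range_succ_iff.1 hj
  have h0 := hpos t ht
  have h1 := hC (i - j) (by omega) (by omega) t ht
  have h2 : |iteratedDeriv j h t| ≤ |K| * h t ^ (j + 1) :=
    (hK j (by omega) t ht).trans (by gcongr; exact le_abs_self K)
  rw [abs_mul, abs_mul, Nat.abs_cast]
  calc (i.choose j : ℝ) * |iteratedDeriv j h t| * |iteratedDeriv (i - j) T t|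
      ≤ i.choose j * (|K| * h t ^ (j + 1)) * (C (i - j) * (h t ^ (i - j) * T t)) := by gcongr
    _ = i.choose j * |K| * C (i - j) * (h t ^ ((j + 1) + (i - j)) * T t) := by
        rw [pow_add]; ring
    _ = _ := by rw [show (j + 1) + (i - j) = i + 1 by omega]

/-- The liminf condition gives `δ log t ≤ t h t`, hence `t h t → ∞`. Once `1 ≤ t h t`, the bound `h
/ t^j` from smooth variation is at most `h^(j+1)`, the form needed by `exists_abs_iteratedDeriv_le`.
-/
theorem exists_tailControl {F : Measure ℝ} {ρ : ℝ} {m : ℕ} (hm : 1 ≤ m) (hρ : ρ < 0)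
    (hs : IsSmoothlyVarying (hazardRate F) ρ m) (h0 : Tendsto (hazardRate F) atTop (𝓝 0))
    (hli : 0 < liminf (fun t : ℝ => ((t * hazardRate F t / Real.log t : ℝ) : EReal)) atTop) :
    ∃ t₁ q K, TailControl (tail F) (hazardRate F) m t₁ q K := by
  set h := hazardRate F with hh
  obtain ⟨δ, hδ0, hδ⟩ : ∃ δ : ℝ, 0 < δ ∧ ∀ᶠ t in atTop, δ < t * h t / Real.log t := by
    obtain ⟨δ, hδ0, hδ⟩ := EReal.lt_iff_exists_real_btwn.1 hli
    refine ⟨δ, by exact_mod_cast hδ0, ?_⟩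
    filter_upwards [eventually_lt_of_lt_liminf hδ] with t ht
    exact_mod_cast ht
  have hlog : ∀ᶠ t in atTop, δ * Real.log t ≤ t * h t := by
    filter_upwards [hδ, Real.tendsto_log_atTop.eventually_gt_atTop 0] with t h1 h2
    rw [lt_div_iff₀ h2] at h1
    exact h1.le
  have hth : Tendsto (fun t => t * h t) atTop atTop :=
    tendsto_atTop_mono' _ hlog (Real.tendsto_log_atTop.const_mul_atTop hδ0)
  have hth1 : ∀ᶠ t in atTop, 1 ≤ t * h t := hth.eventually_ge_atTop 1
  have hpos : ∀ᶠ t in atTop, 0 < h t := by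
    filter_upwards [hth1, eventually_gt_atTop 0] with t h1 h2
    exact pos_of_mul_pos_right (by linarith) h2.le
  obtain ⟨q, K, hq0, hq1, hev⟩ := hs.eventually_bounds hm hρ h0 hpos
  obtain ⟨⟨t₀, hcd⟩, -⟩ := hs
  obtain ⟨t₂, ht₂⟩ := eventually_atTop.1 (((((hev.and hpos).and hth1).and
    (h0.eventually_le_const one_pos)).and (eventually_ge_atTop 1)).and (eventually_gt_atTop t₀))
  have hcd2 : ContDiffOn ℝ m h (Set.Ioi t₂) :=
    hcd.mono (Set.Ioi_subset_Ioi (ht₂ t₂ le_rfl).2.le)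
  have hder : ∀ t ∈ Set.Ioi t₂, HasDerivAt (tail F) (-(h t * tail F t)) t := fun t ht =>
    hasDerivAt_tail_of_hazardRate_pos (ht₂ t (le_of_lt ht)).1.1.1.1.2
  have hTpos : ∀ t, 0 < tail F t := fun t =>
    lt_of_lt_of_le (tail_pos_of_hazardRate_pos (ht₂ _ (le_max_right t t₂)).1.1.1.1.2)
      (tail_antitone F (le_max_left t t₂))
  have hK : ∀ j ≤ m, ∀ t ∈ Set.Ioi t₂, |iteratedDeriv j h t| ≤ |K| * h t ^ (j + 1) := by
    intro j hj t ht
    obtain ⟨⟨⟨⟨⟨h1, h2⟩, h3⟩, h4⟩, h5⟩, -⟩ := ht₂ t (le_of_lt ht)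
    refine (h1.2.2.2 j hj).trans ?_
    have ht0 : 0 < t := by linarith
    have h6 : h t / t ^ j ≤ h t ^ (j + 1) := by
      rw [div_le_iff₀ (by positivity), pow_succ', mul_assoc, ← mul_pow]
      have : 1 ≤ (h t * t) ^ j := one_le_pow₀ (by linarith)
      nlinarith
    have : 0 ≤ h t / t ^ j := by positivity
    calc K * (h t / t ^ j) ≤ |K| * (h t / t ^ j) := by gcongr; exact le_abs_self K
      _ ≤ _ := by gcongr
  have hb : ∀ i ≤ m + 1, ∃ C, 0 ≤ C ∧ ∀ t ∈ Set.Ioi t₂,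
      |iteratedDeriv i (tail F) t| ≤ C * (h t ^ i * tail F t) := fun i hi =>
    exists_abs_iteratedDeriv_le hcd2 hder (fun t _ => (hTpos t).le)
      (fun t ht => (ht₂ t (le_of_lt ht)).1.1.1.1.2.le) hK hi
  choose! C hC0 hC using hb
  have hCsum : 0 ≤ ∑ i ∈ Finset.range (m + 2), C i :=
    Finset.sum_nonneg fun i hi => hC0 i (by have := Finset.mem_range.1 hi; omega)
  have hgt : ∀ t, t₂ + 1 ≤ t → t ∈ Set.Ioi t₂ := fun t ht => by
    rw [Set.mem_Ioi]; linarith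
  have hge : ∀ t, t₂ + 1 ≤ t → t₂ ≤ t := fun t ht => (hgt t ht).le
  have hcdT := contDiffOn_of_hasDerivAt_mul hcd2 hder (le_refl (m + 1))
  -- Derivatives are controlled on the open half-line beyond `t₂`, so a closed one has to start
  -- further right.
  refine ⟨t₂ + 1, q, |K| + ∑ i ∈ Finset.range (m + 2), C i, ?_⟩
  exact
    { antitone := tail_antitone F
      pos := hTpos
      le_one := tail_le_one F
      one_le := by linarith [(ht₂ t₂ le_rfl).1.2]
      q_pos := hq0
      q_lt_one := hq1
      hazard_pos := fun t ht => (ht₂ t (hge t ht)).1.1.1.1.2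
      hazard_le_one := fun t ht => (ht₂ t (hge t ht)).1.1.2
      one_le_mul_hazard := fun t ht => (ht₂ t (hge t ht)).1.1.1.2
      tendsto_mul_hazard := hth
      hazard_antitone := antitoneOn_Ici_of_hasDerivAt_nonpos (f' := deriv h)
        (fun t ht => ((hcd2.differentiableOn (by exact_mod_cast (by omega))).differentiableAt
          (Ioi_mem_nhds (hgt t ht))).hasDerivAt)
        fun t ht => (ht₂ t (hge t ht)).1.1.1.1.1.1.le
      hazard_le_two_mul := fun t ht => by
        have h1 := (ht₂ t (hge t ht)).1.1.1.1.1.2.2.1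
        have h2 := (ht₂ t (hge t ht)).1.2
        have h3 := (ht₂ (2 * t) (by linarith [hge t ht])).1.1.1.1.2
        refine h1.trans ?_
        gcongr
        linarith [le_abs_self K]
      hazard_two_mul_le := fun t ht => (ht₂ t (hge t ht)).1.1.1.1.1.2.1
      hasDerivAt := fun t ht => hder t (hgt t ht)
      hasDerivAt_iteratedDeriv := fun i hi t ht => by
        have heq := fun n : ℕ => iteratedDerivWithin_of_isOpen (n := n) (f := tail F)
          (isOpen_Ioi (a := t₂))
        have h1 : DifferentiableOn ℝ (iteratedDerivWithin i (tail F) (Set.Ioi t₂)) (Set.Ioi t₂) :=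
          hcdT.differentiableOn_iteratedDerivWithin (by exact_mod_cast Nat.lt_succ_of_le hi)
            (uniqueDiffOn_Ioi t₂)
        have h2 := (h1.congr (heq i).symm).differentiableAt (Ioi_mem_nhds (hgt t ht))
        rw [iteratedDeriv_succ]
        exact h2.hasDerivAt
      abs_iteratedDeriv_le := fun i hi t ht => by
        refine (hC i hi t (hgt t ht)).trans ?_
        have : C i ≤ ∑ i ∈ Finset.range (m + 2), C i :=
          Finset.single_le_sum (f := C)
            (fun i hi => hC0 i (by have := Finset.mem_range.1 hi; omega))
            (Finset.mem_range.2 (by omega))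
        have h3 := (ht₂ t (hge t ht)).1.1.1.1.2
        have h4 := hTpos t
        gcongr
        linarith [abs_nonneg K] }

/-! ### Uniform Taylor expansion and inequalities for the tail -/

/-- Taylor expansion at the right end point, with a bound on the remainder. -/
lemma abs_sub_taylor_le {H : ℕ → ℝ → ℝ} {k : ℕ} {a t B : ℝ} (hat : a ≤ t)
    (hH : ∀ i ≤ k, ∀ s ∈ Set.Icc a t, HasDerivAt (H i) (H (i + 1) s) s)
    (hB : ∀ s ∈ Set.Icc a t, |H (k + 1) s| ≤ B) :
    |H 0 a - ∑ j ∈ Finset.range (k + 1), (a - t) ^ j / j.factorial * H j t| ≤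
      B * (t - a) ^ (k + 1) := by
  -- Moving the base point makes the derivative telescope to its top term. The sum is `H 0 a` at `s
  -- = a` and the Taylor polynomial at `s = t`.
  have hder : ∀ s ∈ Set.Icc a t, HasDerivAt
      (fun s => ∑ j ∈ Finset.range (k + 1), (a - s) ^ j / j.factorial * H j s)
      ((a - s) ^ k / k.factorial * H (k + 1) s) s := by
    intro s hs
    clear hB
    induction k with
    | zero => simpa using hH 0 le_rfl s hs
    | succ k ih =>
      simp only [Finset.sum_range_succ _ (k + 1)]
      have h1 := ih fun i hi => hH i (by omega)
      have h2 : HasDerivAt (fun s : ℝ => (a - s) ^ (k + 1) / (k + 1).factorial)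
          (-((a - s) ^ k / k.factorial)) s := by
        have := (((hasDerivAt_id' s).const_sub a).pow (k + 1)).div_const ((k + 1).factorial : ℝ)
        refine this.congr_deriv ?_
        rw [Nat.factorial_succ]
        push_cast
        field_simp
      exact (h1.add (h2.mul (hH (k + 1) le_rfl s hs))).congr_deriv (by ring)
  have hbound := Convex.norm_image_sub_le_of_norm_hasDerivWithin_le
    (C := B * (t - a) ^ k) (fun s hs => (hder s hs).hasDerivWithinAt) (fun s hs => ?_)
    (convex_Icc a t) (Set.left_mem_Icc.2 hat) (Set.right_mem_Icc.2 hat)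
  · rw [abs_sub_comm, pow_succ, ← mul_assoc]
    rw [Real.norm_eq_abs, Real.norm_eq_abs, abs_of_nonneg (sub_nonneg.2 hat)] at hbound
    convert hbound using 3
    rw [Finset.sum_range_succ']
    simp
  · rw [Real.norm_eq_abs, abs_mul, abs_div, abs_pow, Nat.abs_cast, mul_comm B]
    have h0 : |a - s| ≤ t - a := by rw [abs_le]; constructor <;> linarith [hs.1, hs.2]
    have h1 : (1 : ℝ) ≤ k.factorial := by exact_mod_cast Nat.factorial_pos k
    have h2 : |a - s| ^ k / k.factorial ≤ (t - a) ^ k :=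
      (div_le_self (by positivity) h1).trans (by gcongr)
    have := sub_nonneg.2 hat
    have := hB s hs
    gcongr

namespace TailControl

variable {T h : ℝ → ℝ} {m : ℕ} {t₁ q K : ℝ}

lemma hasDerivAt_log (c : TailControl T h m t₁ q K) {t : ℝ} (ht : t₁ ≤ t) :
    HasDerivAt (fun t => Real.log (T t)) (-h t) t :=
  ((c.hasDerivAt t ht).log (c.pos t).ne').congr_deriv (by
    have := (c.pos t).ne'
    field_simp)

lemma log_nonpos (c : TailControl T h m t₁ q K) (t : ℝ) : Real.log (T t) ≤ 0 :=
  Real.log_nonpos (c.pos t).le (c.le_one t)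

lemma log_antitone (c : TailControl T h m t₁ q K) : Antitone fun t => Real.log (T t) :=
  fun _ _ hst => Real.log_le_log (c.pos _) (c.antitone hst)

lemma K_pos (c : TailControl T h m t₁ q K) : 0 < K := by
  have h1 := c.hazard_le_two_mul t₁ le_rfl
  have h2 := c.hazard_pos t₁ le_rfl
  have h3 := c.hazard_pos (2 * t₁) (by linarith [c.one_le])
  by_contra hK
  nlinarith

/-- `(1 + q) log T x - log T (2 x)` has derivative `2 h (2 x) - (1 + q) h x ≤ (q - 1) h x < 0`. This
yields `T x ≤ e^A T (2 x) T(x)^(-q)`, the case `t = 2 x` of `exists_sub_le`. -/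
lemma exists_log_two_mul (c : TailControl T h m t₁ q K) :
    ∃ A, ∀ x, t₁ ≤ x → Real.log (T x) - Real.log (T (2 * x)) ≤ -q * Real.log (T x) + A := by
  have hanti : AntitoneOn (fun x => (1 + q) * Real.log (T x) - Real.log (T (2 * x)))
      (Set.Ici t₁) := by
    refine antitoneOn_Ici_of_hasDerivAt_nonpos
      (f' := fun x => (1 + q) * (-h x) - (-h (2 * x) * (2 * 1))) (fun x hx => ?_) fun x hx => ?_
    · refine ((c.hasDerivAt_log hx).const_mul (1 + q)).sub ?_
      exact HasDerivAt.comp x (c.hasDerivAt_log (by linarith [c.one_le]))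
        ((hasDerivAt_id' x).const_mul 2)
    · have h1 := c.hazard_two_mul_le x hx
      have h2 := c.hazard_pos x hx
      nlinarith [c.q_lt_one]
  refine ⟨(1 + q) * Real.log (T t₁) - Real.log (T (2 * t₁)), fun x hx => ?_⟩
  have := hanti Set.self_mem_Ici hx hx
  simp only at this
  linarith

/-- Comparison of the tail at `t - x` and at `t`, uniformly in `0 ≤ x ≤ t / 2`. -/
lemma exists_sub_le (c : TailControl T h m t₁ q K) :
    ∃ A, 0 < A ∧ ∀ t x, 2 * t₁ ≤ t → 2 * x ≤ t → T (t - x) ≤ A * T t * T x ^ (-q) := by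
  obtain ⟨A, hA⟩ := c.exists_log_two_mul
  refine ⟨Real.exp (A - q * Real.log (T t₁)), Real.exp_pos _, fun t x ht hx => ?_⟩
  -- The hazard rate is controlled only beyond `t₁`. Replacing `x` by `y` costs the constant factor
  -- `T(t₁)^(-q)`.
  set y := max x t₁ with hy
  have hy1 : t₁ ≤ y := le_max_right _ _
  have hyt : 2 * y ≤ t := by
    rcases max_choice x t₁ with h | h <;> rw [hy, h] <;> assumption
  -- Since `h` decreases, this difference is largest at `s = 2 * y`, where `exists_log_two_mul`
  -- bounds it.
  have hanti : AntitoneOn (fun s => Real.log (T (s - y)) - Real.log (T s)) (Set.Ici (2 * y)) := by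
    refine antitoneOn_Ici_of_hasDerivAt_nonpos
      (f' := fun s => -h (s - y) * 1 - (-h s)) (fun s hs => ?_) fun s hs => ?_
    · exact (HasDerivAt.comp s (c.hasDerivAt_log (by linarith))
        ((hasDerivAt_id' s).sub_const y)).sub (c.hasDerivAt_log (by linarith [c.one_le]))
    · have := c.hazard_antitone (show t₁ ≤ s - y by linarith) (show t₁ ≤ s by linarith [c.one_le])
        (by linarith [c.one_le])
      linarith
  have h1 := hanti Set.self_mem_Ici hyt hyt
  simp only at h1
  rw [show 2 * y - y = y by ring] at h1
  have h2 := hA y hy1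
  have h3 : Real.log (T (t - x)) ≤ Real.log (T (t - y)) :=
    c.log_antitone (by linarith [le_max_left x t₁])
  have h4 : -q * Real.log (T y) ≤ -q * Real.log (T x) + -q * Real.log (T t₁) := by
    have a1 := c.log_nonpos x
    have a2 := c.log_nonpos t₁
    have a3 := c.q_pos
    rcases max_choice x t₁ with h | h <;> rw [hy, h] <;> nlinarith
  calc T (t - x) = Real.exp (Real.log (T (t - x))) := (Real.exp_log (c.pos _)).symm
    _ ≤ Real.exp (A - q * Real.log (T t₁) + Real.log (T t) + Real.log (T x) * (-q)) :=
        Real.exp_le_exp.2 (by linarith)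
    _ = _ := by
        rw [Real.exp_add, Real.exp_add, Real.exp_log (c.pos _), ← Real.rpow_def_of_pos (c.pos _)]

lemma one_le_rpow_neg (c : TailControl T h m t₁ q K) {s : ℝ} (hs : 0 ≤ s) (x : ℝ) :
    1 ≤ T x ^ (-s) :=
  Real.one_le_rpow_of_pos_of_le_one_of_nonpos (c.pos x) (c.le_one x) (by linarith)

/-- This makes negative powers of `T` submultiplicative up to a constant. For `y ≤ x`,
`exists_sub_le` gives `T x ≤ A T(x + y) T(y)^(-q)`, and the spare factor `T y` absorbs the negative
power since `q < 1`. For `x + y ≤ 2 t₁` the right side is bounded below. -/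
lemma exists_mul_le_add (c : TailControl T h m t₁ q K) :
    ∃ A, 0 < A ∧ ∀ x y, 0 ≤ x → 0 ≤ y → T x * T y ≤ A * T (x + y) := by
  obtain ⟨A, hA, hAb⟩ := c.exists_sub_le
  have hT := c.pos (2 * t₁)
  refine ⟨A + (T (2 * t₁))⁻¹, by positivity, ?_⟩
  suffices H : ∀ x y, 0 ≤ x → 0 ≤ y → y ≤ x → T x * T y ≤ (A + (T (2 * t₁))⁻¹) * T (x + y) by
    intro x y hx hy
    rcases le_total y x with h | h
    · exact H x y hx hy h
    · rw [mul_comm, add_comm x y]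
      exact H y x hy hx h
  intro x y hx hy hyx
  have p1 := c.pos x
  have p2 := c.pos y
  have p3 := c.pos (x + y)
  rcases le_total (2 * t₁) (x + y) with h | h
  · have h1 := hAb (x + y) y h (by linarith)
    rw [add_sub_cancel_right] at h1
    have h2 : T y ^ (-q) * T y ≤ 1 := by
      nth_rewrite 2 [← Real.rpow_one (T y)]
      rw [← Real.rpow_add p2]
      exact Real.rpow_le_one p2.le (c.le_one y) (by linarith [c.q_lt_one])
    calc T x * T y ≤ A * T (x + y) * T y ^ (-q) * T y := by gcongr
      _ = A * T (x + y) * (T y ^ (-q) * T y) := by ring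
      _ ≤ A * T (x + y) * 1 := by gcongr
      _ ≤ _ := by
        have : 0 ≤ (T (2 * t₁))⁻¹ * T (x + y) := by positivity
        linarith
  · have h1 : T (2 * t₁) ≤ T (x + y) := c.antitone h
    have h2 : 1 ≤ (T (2 * t₁))⁻¹ * T (x + y) := by
      rw [inv_mul_eq_div, le_div_iff₀ hT]; linarith
    have h3 : T x * T y ≤ 1 := mul_le_one₀ (c.le_one x) p2.le (c.le_one y)
    nlinarith [mul_pos hA p3]

/-- The tail decays faster than any power. -/
lemma exists_pow_mul_rpow_le (c : TailControl T h m t₁ q K) (p : ℕ) {η : ℝ} (hη : 0 < η) :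
    ∃ A, 0 < A ∧ ∀ x, 0 ≤ x → x ^ p * T x ^ η ≤ A := by
  obtain ⟨t₂, h2⟩ := eventually_atTop.1 ((c.tendsto_mul_hazard.eventually_ge_atTop (p / η)).and
    (eventually_ge_atTop t₁))
  have ht2 : t₁ ≤ t₂ := (h2 t₂ le_rfl).2
  have hpos : ∀ t, t₂ ≤ t → 0 < t := fun t ht => by linarith [c.one_le]
  -- The derivative `p / t - η h t` is nonpositive as soon as `t h t ≥ p / η`.
  have hanti : AntitoneOn (fun t => p * Real.log t + η * Real.log (T t)) (Set.Ici t₂) := by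
    refine antitoneOn_Ici_of_hasDerivAt_nonpos (f' := fun t => p * t⁻¹ + η * (-h t))
      (fun t ht => ((Real.hasDerivAt_log (hpos t ht).ne').const_mul _).add
        ((c.hasDerivAt_log (ht2.trans ht)).const_mul _)) fun t ht => ?_
    have h3 := (h2 t ht).1
    have h4 := hpos t ht
    rw [div_le_iff₀ hη] at h3
    have : (p : ℝ) * t⁻¹ ≤ t * h t * η * t⁻¹ := by gcongr
    have h5 : t * h t * η * t⁻¹ = η * h t := by field_simp
    linarith
  have hp2 := hpos t₂ le_rfl
  have hbase : ∀ t, t₂ ≤ t → t ^ p * T t ^ η ≤ t₂ ^ p * T t₂ ^ η := by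
    intro t ht
    have h1 : ∀ t, t₂ ≤ t →
        t ^ p * T t ^ η = Real.exp (p * Real.log t + η * Real.log (T t)) := by
      intro t ht
      rw [Real.exp_add, mul_comm (p : ℝ), mul_comm η, ← Real.rpow_def_of_pos (hpos t ht),
        ← Real.rpow_def_of_pos (c.pos t), Real.rpow_natCast]
    rw [h1 t ht, h1 t₂ le_rfl]
    exact Real.exp_le_exp.2 (hanti Set.self_mem_Ici ht ht)
  have hle1 : ∀ t, T t ^ η ≤ 1 := fun t => Real.rpow_le_one (c.pos t).le (c.le_one t) hη.le
  refine ⟨t₂ ^ p, by positivity, fun x hx => ?_⟩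
  have a3 := Real.rpow_pos_of_pos (c.pos t₂) η
  rcases le_total t₂ x with h | h
  · exact (hbase x h).trans (mul_le_of_le_one_right (by positivity) (hle1 t₂))
  · calc x ^ p * T x ^ η ≤ x ^ p * 1 := by gcongr; exact hle1 x
      _ ≤ t₂ ^ p := by rw [mul_one]; gcongr

lemma hazard_sub_le (c : TailControl T h m t₁ q K) {t s : ℝ} (ht : 2 * t₁ ≤ t) (hs : t ≤ 2 * s) :
    h s ≤ K * h t := by
  have h1 := c.hazard_le_two_mul (t / 2) (by linarith)
  rw [mul_div_cancel₀ _ two_ne_zero] at h1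
  exact (c.hazard_antitone (show t₁ ≤ t / 2 by linarith) (show t₁ ≤ s by linarith)
    (by linarith)).trans h1

/-- The exponent `(1 + q) / 2` is the midpoint of `q` and 1. Being above `q`, it leaves
`T^((1-q)/2)` to absorb powers of `x`; being below 1, it keeps the weight integrable. -/
lemma exists_pow_mul_rpow_le_weight (c : TailControl T h m t₁ q K) (r : ℕ) :
    ∃ A, 0 < A ∧ ∀ p ≤ r, ∀ x, 0 ≤ x → x ^ p * T x ^ (-q) ≤ A * T x ^ (-((1 + q) / 2)) := by
  have hη : 0 < (1 - q) / 2 := by linarith [c.q_lt_one]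
  obtain ⟨A, hA, hAb⟩ := c.exists_pow_mul_rpow_le r hη
  refine ⟨1 + A, by positivity, fun p hp x hx => ?_⟩
  have h1 : x ^ p ≤ 1 + x ^ r := by
    rcases le_total x 1 with h | h
    · have := pow_le_one₀ (n := p) hx h
      have : 0 ≤ x ^ r := by positivity
      linarith
    · have := pow_le_pow_right₀ h hp
      linarith
  have h2 : T x ^ (-q) = T x ^ ((1 - q) / 2) * T x ^ (-((1 + q) / 2)) := by
    rw [← Real.rpow_add (c.pos x)]; congr 1; ring
  have h3 : x ^ p * T x ^ ((1 - q) / 2) ≤ 1 + A := by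
    have a1 := Real.rpow_pos_of_pos (c.pos x) ((1 - q) / 2)
    calc x ^ p * T x ^ ((1 - q) / 2) ≤ (1 + x ^ r) * T x ^ ((1 - q) / 2) := by gcongr
      _ = T x ^ ((1 - q) / 2) + x ^ r * T x ^ ((1 - q) / 2) := by ring
      _ ≤ 1 + A := add_le_add (Real.rpow_le_one (c.pos x).le (c.le_one x) hη.le) (hAb x hx)
  rw [h2, ← mul_assoc]
  have a2 := Real.rpow_pos_of_pos (c.pos x) (-((1 + q) / 2))
  gcongr

/-- `exists_sub_le` at `x = t / 2` bounds the square by `A T(t) T(t/2)^(1-q)`. The last factor is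
`O(t^(-(m+1)))`, hence `O(h^(m+1))` because `t h t ≥ 1`. -/
lemma exists_sq_half_le (c : TailControl T h m t₁ q K) :
    ∃ A, 0 < A ∧ ∀ t, 2 * t₁ ≤ t → T (t / 2) * T (t / 2) ≤ A * (h t ^ (m + 1) * T t) := by
  obtain ⟨A, hA, hAb⟩ := c.exists_sub_le
  obtain ⟨B, hB, hBb⟩ := c.exists_pow_mul_rpow_le (m + 1) (show 0 < 1 - q by linarith [c.q_lt_one])
  refine ⟨A * (B * 2 ^ (m + 1)), by positivity, fun t ht => ?_⟩
  have ht0 : 0 < t := by linarith [c.one_le]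
  have hp := c.pos (t / 2)
  have hpt := c.pos t
  have h1 := hAb t (t / 2) ht (by linarith)
  rw [sub_half] at h1
  have h2 := hBb (t / 2) (by positivity)
  have h3 : 1 ≤ (t * h t) ^ (m + 1) := one_le_pow₀ (c.one_le_mul_hazard t (by linarith [c.one_le]))
  have h4 : T (t / 2) ^ (-q) * T (t / 2) = T (t / 2) ^ (1 - q) := by
    nth_rewrite 2 [← Real.rpow_one (T (t / 2))]
    rw [← Real.rpow_add hp]; congr 1; ring
  have hh := c.hazard_pos t (by linarith [c.one_le])
  have h5 : T (t / 2) ^ (1 - q) ≤ B * 2 ^ (m + 1) * h t ^ (m + 1) := by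
    have a0 := Real.rpow_pos_of_pos hp (1 - q)
    calc T (t / 2) ^ (1 - q) ≤ (t * h t) ^ (m + 1) * T (t / 2) ^ (1 - q) :=
          le_mul_of_one_le_left a0.le h3
      _ = ((t / 2) ^ (m + 1) * T (t / 2) ^ (1 - q)) * (2 ^ (m + 1) * h t ^ (m + 1)) := by
          rw [← mul_pow, show t * h t = t / 2 * (2 * h t) by ring, mul_pow]; ring
      _ ≤ B * (2 ^ (m + 1) * h t ^ (m + 1)) := by gcongr
      _ = _ := by ring
  calc T (t / 2) * T (t / 2) ≤ A * T t * T (t / 2) ^ (-q) * T (t / 2) := by gcongr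
    _ = A * T t * T (t / 2) ^ (1 - q) := by rw [mul_assoc, h4]
    _ ≤ A * T t * (B * 2 ^ (m + 1) * h t ^ (m + 1)) := by gcongr
    _ = _ := by ring

/-- Controls Taylor remainders at intermediate points: such `s` is at least `t / 2`, where `h s ≤ K
h t`. -/
lemma exists_hazard_pow_mul_sub_le (c : TailControl T h m t₁ q K) :
    ∃ A, 0 < A ∧ ∀ t x s, 2 * t₁ ≤ t → 2 * x ≤ t → t - x ≤ s → s ≤ t →
      h s ^ (m + 1) * T s ≤ A * (h t ^ (m + 1) * T t) * T x ^ (-q) := by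
  obtain ⟨A, hA, hAb⟩ := c.exists_sub_le
  have hK := c.K_pos
  refine ⟨K ^ (m + 1) * A, by positivity, fun t x s ht hx hs hst => ?_⟩
  have p1 := c.hazard_pos s (by linarith)
  have p2 := c.hazard_pos t (by linarith)
  have p3 := c.pos t
  have p4 := c.pos s
  have h1 := c.hazard_sub_le ht (show t ≤ 2 * s by linarith)
  have h2 := (c.antitone hs).trans (hAb t x ht hx)
  calc h s ^ (m + 1) * T s ≤ (K * h t) ^ (m + 1) * (A * T t * T x ^ (-q)) := by gcongr
    _ = _ := by rw [mul_pow]; ring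

/-- Taylor expansion of `T^{(i)} (t - x)` on `x ≤ t / 2`, with a remainder controlled by the weight
`T ^ (-(1 + q) / 2)` uniformly in `x`. -/
lemma exists_abs_indicator_sub_taylor_le (c : TailControl T h m t₁ q K) :
    ∃ A, 0 < A ∧ ∀ i ≤ m, ∀ t x, 2 * t₁ ≤ t → 0 ≤ x →
      |(Set.Iic (t / 2)).indicator (fun x => iteratedDeriv i T (t - x)) x -
        ∑ j ∈ Finset.range (m - i + 1), (-x) ^ j / j.factorial * iteratedDeriv (i + j) T t| ≤
      A * (h t ^ (m + 1) * T t) * T x ^ (-((1 + q) / 2)) := by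
  obtain ⟨A, hA, hAb⟩ := c.exists_hazard_pow_mul_sub_le
  -- The largest power needed is `2 * m + 1`: at most `m` from a Taylor term and `m + 1` inserted
  -- when `x > t / 2`.
  obtain ⟨B, hB, hBb⟩ := c.exists_pow_mul_rpow_le_weight (2 * m + 1)
  have hK := c.K_pos
  refine ⟨K * A * B + (m + 1) * (K * 2 ^ (m + 1) * B), by positivity, fun i hi t x ht hx => ?_⟩
  have ht1 : t₁ ≤ t := by linarith [c.one_le]
  have ht0 : 0 < t := by linarith [c.one_le]
  have p2 := c.hazard_pos t ht1
  have p3 := c.pos t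
  have pw := Real.rpow_pos_of_pos (c.pos x) (-((1 + q) / 2))
  have pq := Real.rpow_pos_of_pos (c.pos x) (-q)
  rcases le_or_gt x (t / 2) with hxt | hxt
  · rw [Set.indicator_of_mem (by exact hxt)]
    have h1 := abs_sub_taylor_le (H := fun j => iteratedDeriv (i + j) T) (k := m - i)
      (a := t - x) (t := t) (B := K * (A * (h t ^ (m + 1) * T t) * T x ^ (-q))) (by linarith)
      (fun j hj s hs => c.hasDerivAt_iteratedDeriv (i + j) (by omega) s (by linarith [hs.1]))
      (fun s hs => by
        have a1 := c.abs_iteratedDeriv_le (m + 1) le_rfl s (by linarith [hs.1])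
        have a2 := hAb t x s ht (by linarith) hs.1 hs.2
        rw [show i + (m - i + 1) = m + 1 by omega]
        exact a1.trans (by gcongr))
    simp only [sub_sub_cancel_left, sub_sub_cancel, add_zero] at h1
    refine h1.trans ?_
    have h2 := hBb (m - i + 1) (by omega) x hx
    calc K * (A * (h t ^ (m + 1) * T t) * T x ^ (-q)) * x ^ (m - i + 1)
        = K * A * (h t ^ (m + 1) * T t) * (x ^ (m - i + 1) * T x ^ (-q)) := by ring
      _ ≤ K * A * (h t ^ (m + 1) * T t) * (B * T x ^ (-((1 + q) / 2))) := by gcongr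
      _ = K * A * B * (h t ^ (m + 1) * T t) * T x ^ (-((1 + q) / 2)) := by ring
      _ ≤ _ := by
        gcongr
        have : 0 ≤ (m + 1) * (K * 2 ^ (m + 1) * B) := by positivity
        linarith
  · rw [Set.indicator_of_notMem (by simpa using hxt), zero_sub, abs_neg]
    -- Here `2 x h t ≥ t h t ≥ 1`, so this factor can be inserted. It supplies the missing `h^(m+1)`
    -- at the price of powers of `x`, absorbed by the weight.
    have h1 : 1 ≤ (2 * x * h t) ^ (m + 1) := one_le_pow₀ (by
      nlinarith [c.one_le_mul_hazard t ht1])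
    have hterm : ∀ j ∈ Finset.range (m - i + 1),
        |(-x) ^ j / j.factorial * iteratedDeriv (i + j) T t| ≤
          K * 2 ^ (m + 1) * B * (h t ^ (m + 1) * T t) * T x ^ (-((1 + q) / 2)) := by
      intro j hj
      have hj' := Finset.mem_range_succ_iff.1 hj
      have a1 := c.abs_iteratedDeriv_le (i + j) (by omega) t ht1
      have a2 : h t ^ (i + j) ≤ 1 := pow_le_one₀ p2.le (c.hazard_le_one t ht1)
      have a3 : (1 : ℝ) ≤ j.factorial := by exact_mod_cast Nat.factorial_pos j
      have a4 : |(-x) ^ j / j.factorial| ≤ x ^ j := by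
        rw [abs_div, abs_pow, abs_neg, abs_of_nonneg hx, Nat.abs_cast]
        exact div_le_self (by positivity) a3
      have a5 := hBb (j + (m + 1)) (by omega) x hx
      have a6 : x ^ (j + (m + 1)) ≤ B * T x ^ (-((1 + q) / 2)) :=
        le_trans (le_mul_of_one_le_right (by positivity) (c.one_le_rpow_neg c.q_pos.le x)) a5
      rw [abs_mul]
      calc |(-x) ^ j / j.factorial| * |iteratedDeriv (i + j) T t|
          ≤ x ^ j * (K * (1 * T t)) := by
            gcongr
            exact a1.trans (by gcongr)
        _ ≤ x ^ j * (K * (1 * T t)) * (2 * x * h t) ^ (m + 1) :=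
            le_mul_of_one_le_right (by positivity) h1
        _ = K * 2 ^ (m + 1) * (h t ^ (m + 1) * T t) * x ^ (j + (m + 1)) := by
            rw [mul_pow, mul_pow, pow_add]; ring
        _ ≤ K * 2 ^ (m + 1) * (h t ^ (m + 1) * T t) * (B * T x ^ (-((1 + q) / 2))) := by gcongr
        _ = _ := by ring
    refine (Finset.abs_sum_le_sum_abs _ _).trans ((Finset.sum_le_sum hterm).trans ?_)
    rw [Finset.sum_const, Finset.card_range, nsmul_eq_mul]
    have h2 : ((m - i + 1 : ℕ) : ℝ) ≤ m + 1 := by exact_mod_cast (by omega : m - i + 1 ≤ m + 1)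
    calc ((m - i + 1 : ℕ) : ℝ) *
          (K * 2 ^ (m + 1) * B * (h t ^ (m + 1) * T t) * T x ^ (-((1 + q) / 2)))
        ≤ (m + 1) * (K * 2 ^ (m + 1) * B * (h t ^ (m + 1) * T t) * T x ^ (-((1 + q) / 2))) := by
          gcongr
      _ = (m + 1) * (K * 2 ^ (m + 1) * B) * (h t ^ (m + 1) * T t) * T x ^ (-((1 + q) / 2)) := by
          ring
      _ ≤ _ := by
        gcongr
        have : 0 ≤ K * A * B := by positivity
        linarith

/-- Powers `T ^ (-s)`, `s < 1`, of the tail of `F` are integrable with respect to `F`. -/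
lemma integrable_rpow_neg {F : Measure ℝ} [IsProbabilityMeasure F]
    (c : TailControl (tail F) h m t₁ q K) {s : ℝ} (hs0 : 0 < s) (hs1 : s < 1) :
    Integrable (fun x => tail F x ^ (-s)) F := by
  have hmeas : Measurable fun x => tail F x ^ (-s) := c.antitone.measurable.pow_const _
  have hnn : ∀ x, 0 ≤ tail F x ^ (-s) := fun x => (Real.rpow_pos_of_pos (c.pos x) _).le
  -- Near zero, `T` at an `F`-random point is dominated as a uniform variable is: continuity gives
  -- `u = T y`, and `T x < u` forces `x > y`.
  have hsmall : ∀ u, 0 < u → u ≤ tail F t₁ → F {x | tail F x < u} ≤ ENNReal.ofReal u := by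
    intro u hu hut
    obtain ⟨t₂, ht₂, ht₂'⟩ := (((tendsto_tail_atTop F).eventually_lt_const hu).and
      (eventually_ge_atTop t₁)).exists
    obtain ⟨y, -, hy⟩ := intermediate_value_Icc' ht₂'
      (fun t ht => (c.hasDerivAt t ht.1).continuousAt.continuousWithinAt) ⟨ht₂.le, hut⟩
    calc F {x | tail F x < u} ≤ F (Set.Ioi y) := by
          refine measure_mono fun x hx => ?_
          by_contra hxy
          exact absurd (c.antitone (not_lt.1 hxy)) (by rw [hy]; exact not_le.2 hx)
      _ = ENNReal.ofReal u := by
          rw [← hy, tail_eq_real, Measure.real, ENNReal.ofReal_toReal (measure_ne_top _ _)]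
  refine ⟨hmeas.aestronglyMeasurable, ?_⟩
  rw [hasFiniteIntegral_iff_ofReal (ae_of_all _ hnn),
    lintegral_eq_lintegral_meas_lt F (ae_of_all _ hnn) hmeas.aemeasurable]
  set S := tail F t₁ ^ (-s) with hS
  have hS0 : 0 < S := Real.rpow_pos_of_pos (c.pos t₁) _
  rw [← Set.Ioc_union_Ioi_eq_Ioi hS0.le]
  refine (lintegral_union_le _ _ _).trans_lt (ENNReal.add_lt_top.2 ⟨?_, ?_⟩)
  · calc ∫⁻ y in Set.Ioc 0 S, F {x | y < tail F x ^ (-s)}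
        ≤ ∫⁻ _ in Set.Ioc 0 S, 1 := lintegral_mono fun y => prob_le_one
      _ < ⊤ := by simp
  · have hint := integrableOn_Ioi_rpow_of_lt (a := -(1 / s)) (c := S)
      (by rw [neg_lt_neg_iff, lt_div_iff₀ hs0]; linarith) hS0
    refine lt_of_le_of_lt (setLIntegral_mono' measurableSet_Ioi fun y hy => ?_)
      hint.lintegral_lt_top
    have hy0 : 0 < y := hS0.trans hy
    have hpow : ∀ z : ℝ, 0 < z → (z ^ (-s)) ^ (-(1 / s)) = z := fun z hz => by
      rw [← Real.rpow_mul hz.le, neg_mul_neg, mul_one_div_cancel hs0.ne', Real.rpow_one]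
    refine le_trans (measure_mono fun x hx => ?_) (hsmall (y ^ (-(1 / s)))
      (Real.rpow_pos_of_pos hy0 _) ?_)
    · change y < tail F x ^ (-s) at hx
      change tail F x < y ^ (-(1 / s))
      rw [← hpow _ (c.pos x)]
      exact Real.rpow_lt_rpow_of_neg hy0 hx (by rw [neg_lt_zero]; positivity)
    · rw [← hpow _ (c.pos t₁)]
      exact (Real.rpow_lt_rpow_of_neg hS0 hy (by rw [neg_lt_zero]; positivity)).le

end TailControl

/-! ### Convolutions, their tails and their Laplace characters -/

noncomputable section

/-- The coefficient of order `i` of the Laplace character. -/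
def laplaceCoeff (F : Measure ℝ) (i : ℕ) : ℝ := (-1) ^ i / (i.factorial : ℝ) * moment id i F

/-- The Laplace character of order `m` applied to a function. -/
def laplaceApply (H : Measure ℝ) (m : ℕ) (T : ℝ → ℝ) (t : ℝ) : ℝ :=
  ∑ i ∈ Finset.range (m + 1), laplaceCoeff H i * iteratedDeriv i T t

/-- The part of the convolution of `f` with `H` carried by `(-∞, t / 2]`. -/
def halfConv (f : ℝ → ℝ) (H : Measure ℝ) (t : ℝ) : ℝ :=
  ∫ x, (Set.Iic (t / 2)).indicator (fun x => f (t - x)) x ∂H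

/-- Convolution powers of a measure on the line. -/
def convPow (F : Measure ℝ) : ℕ → Measure ℝ
  | 0 => Measure.dirac 0
  | n + 1 => (convPow F n).conv F

instance convPow.isProbabilityMeasure (F : Measure ℝ) [IsProbabilityMeasure F] (n : ℕ) :
    IsProbabilityMeasure (convPow F n) := by
  induction n with
  | zero => exact Measure.dirac.isProbabilityMeasure
  | succ n ih =>
    have := ih
    exact Measure.probabilitymeasure_of_probabilitymeasures_conv _ _

lemma moment_id_eq (H : Measure ℝ) (i : ℕ) : moment id i H = ∫ x, x ^ i ∂H := rfl

lemma conv_apply_Ioi (μ ν : Measure ℝ) (t : ℝ) :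
    (μ.conv ν) (Set.Ioi t) = (μ.prod ν) {p | t < p.1 + p.2} := by
  rw [Measure.conv, Measure.map_apply (by fun_prop) measurableSet_Ioi]
  rfl

/-- Decomposition of the tail of a convolution according to whether both summands, or only one of
them, exceed `t / 2`. -/
lemma tail_conv (μ ν : Measure ℝ) [IsProbabilityMeasure μ] [IsProbabilityMeasure ν] (t : ℝ) :
    tail (μ.conv ν) t =
      halfConv (tail μ) ν t + halfConv (tail ν) μ t + tail μ (t / 2) * tail ν (t / 2) := by
  set A : Set (ℝ × ℝ) := {p | p.2 ≤ t / 2 ∧ t - p.2 < p.1} with hA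
  set B : Set (ℝ × ℝ) := {p | p.1 ≤ t / 2 ∧ t - p.1 < p.2} with hB
  set D : Set (ℝ × ℝ) := Set.Ioi (t / 2) ×ˢ Set.Ioi (t / 2) with hD
  have mA : MeasurableSet A := (measurableSet_le measurable_snd measurable_const).inter
    (measurableSet_lt (by fun_prop) measurable_fst)
  have mB : MeasurableSet B := (measurableSet_le measurable_fst measurable_const).inter
    (measurableSet_lt (by fun_prop) measurable_snd)
  have mD : MeasurableSet D := measurableSet_Ioi.prod measurableSet_Ioi
  have hunion : {p : ℝ × ℝ | t < p.1 + p.2} = A ∪ B ∪ D := by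
    ext ⟨x, y⟩
    simp only [hA, hB, hD, Set.mem_union, Set.mem_ofPred_eq, Set.mem_prod, Set.mem_Ioi]
    constructor
    · intro h
      rcases le_or_gt y (t / 2) with hy | hy
      · exact Or.inl (Or.inl ⟨hy, by linarith⟩)
      · rcases le_or_gt x (t / 2) with hx | hx
        · exact Or.inl (Or.inr ⟨hx, by linarith⟩)
        · exact Or.inr ⟨hx, hy⟩
    · rintro ((⟨_, h⟩ | ⟨_, h⟩) | ⟨h1, h2⟩) <;> linarith
  have dAB : Disjoint A B := by
    rw [Set.disjoint_left]
    rintro ⟨x, y⟩ h1 h2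
    have a1 : y ≤ t / 2 := h1.1
    have a2 : t - y < x := h1.2
    have a3 : x ≤ t / 2 := h2.1
    linarith
  have dABD : Disjoint (A ∪ B) D := by
    rw [Set.disjoint_left]
    rintro ⟨x, y⟩ h1 h2
    have a1 : t / 2 < x := h2.1
    have a2 : t / 2 < y := h2.2
    rcases h1 with h1 | h1
    · have a3 : y ≤ t / 2 := h1.1
      linarith
    · have a3 : x ≤ t / 2 := h1.1
      linarith
  have hmeas : ∀ κ : Measure ℝ, Measurable fun x => κ (Set.Ioi (t - x)) := fun κ =>
    (show Monotone fun x => κ (Set.Ioi (t - x)) from fun x y hxy =>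
      measure_mono (Set.Ioi_subset_Ioi (by linarith))).measurable
  have hhalf : ∀ (κ η : Measure ℝ) [IsProbabilityMeasure κ] [IsProbabilityMeasure η],
      halfConv (tail κ) η t = (∫⁻ x in Set.Iic (t / 2), κ (Set.Ioi (t - x)) ∂η).toReal := by
    intro κ η _ _
    rw [halfConv, integral_indicator measurableSet_Iic,
      ← integral_toReal (hmeas κ).aemeasurable (ae_of_all _ fun x => measure_lt_top _ _)]
    simp_rw [tail_eq_real, Measure.real]
  have hAm : (μ.prod ν) A = ∫⁻ x in Set.Iic (t / 2), μ (Set.Ioi (t - x)) ∂ν := by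
    rw [Measure.prod_apply_symm mA, ← lintegral_indicator measurableSet_Iic]
    refine lintegral_congr fun y => ?_
    by_cases hy : y ≤ t / 2
    · rw [Set.indicator_of_mem (by exact hy)]
      congr 1
      ext x
      simp [hA, hy]
    · rw [Set.indicator_of_notMem (by exact hy)]
      convert measure_empty (μ := μ)
      ext x
      simp [hA, hy]
  have hBm : (μ.prod ν) B = ∫⁻ x in Set.Iic (t / 2), ν (Set.Ioi (t - x)) ∂μ := by
    rw [Measure.prod_apply mB, ← lintegral_indicator measurableSet_Iic]
    refine lintegral_congr fun y => ?_
    by_cases hy : y ≤ t / 2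
    · rw [Set.indicator_of_mem (by exact hy)]
      congr 1
      ext x
      simp [hB, hy]
    · rw [Set.indicator_of_notMem (by exact hy)]
      convert measure_empty (μ := ν)
      ext x
      simp [hB, hy]
  rw [tail_eq_real, Measure.real, conv_apply_Ioi, hunion, measure_union dABD mD,
    measure_union dAB mB, ENNReal.toReal_add (by finiteness) (by finiteness),
    ENNReal.toReal_add (by finiteness) (by finiteness), hhalf μ ν, hhalf ν μ, ← hAm, ← hBm, hD,
    Measure.prod_prod, ENNReal.toReal_mul, tail_eq_real, tail_eq_real]
  rfl

lemma ae_nonneg_of_Iio {H : Measure ℝ} (hH : H (Set.Iio 0) = 0) : ∀ᵐ x ∂H, 0 ≤ x := by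
  rw [ae_iff]
  convert hH using 2
  ext x; simp

lemma ae_prod_nonneg {μ ν : Measure ℝ} [SFinite μ] [SFinite ν]
    (hμ : μ (Set.Iio 0) = 0) (hν : ν (Set.Iio 0) = 0) : ∀ᵐ p ∂(μ.prod ν), 0 ≤ p.1 ∧ 0 ≤ p.2 := by
  have h1 : ∀ᵐ p ∂(μ.prod ν), 0 ≤ p.1 := Measure.quasiMeasurePreserving_fst.ae (ae_nonneg_of_Iio hμ)
  have h2 : ∀ᵐ p ∂(μ.prod ν), 0 ≤ p.2 := Measure.quasiMeasurePreserving_snd.ae (ae_nonneg_of_Iio hν)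
  filter_upwards [h1, h2] with p a b using ⟨a, b⟩

lemma conv_Iio_zero {μ ν : Measure ℝ} [SFinite μ] [SFinite ν]
    (hμ : μ (Set.Iio 0) = 0) (hν : ν (Set.Iio 0) = 0) : (μ.conv ν) (Set.Iio 0) = 0 := by
  rw [Measure.conv, Measure.map_apply (by fun_prop) measurableSet_Iio]
  refine measure_mono_null (fun p hp => ?_) (ae_iff.1 (ae_prod_nonneg hμ hν))
  change p.1 + p.2 < 0 at hp
  change ¬ (0 ≤ p.1 ∧ 0 ≤ p.2)
  rintro ⟨h1, h2⟩
  linarith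

lemma convPow_Iio_zero {F : Measure ℝ} [IsProbabilityMeasure F] (hF : F (Set.Iio 0) = 0) (n : ℕ) :
    convPow F n (Set.Iio 0) = 0 := by
  induction n with
  | zero => simp [convPow]
  | succ n ih => exact conv_Iio_zero ih hF

/-- The Laplace character is multiplicative. -/
lemma laplaceCoeff_conv {μ ν : Measure ℝ} [IsProbabilityMeasure μ] [IsProbabilityMeasure ν] {k : ℕ}
    (hμ : ∀ i ≤ k, Integrable (fun x : ℝ => x ^ i) μ)
    (hν : ∀ i ≤ k, Integrable (fun x : ℝ => x ^ i) ν) :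
    laplaceCoeff (μ.conv ν) k =
      ∑ i ∈ Finset.range (k + 1), laplaceCoeff μ i * laplaceCoeff ν (k - i) := by
  have hint : ∀ i ∈ Finset.range (k + 1), Integrable
      (fun p : ℝ × ℝ => p.1 ^ i * p.2 ^ (k - i) * (k.choose i : ℝ)) (μ.prod ν) := fun i hi =>
    ((hμ i (Finset.mem_range_succ_iff.1 hi)).mul_prod (hν (k - i) (by omega))).mul_const _
  simp only [laplaceCoeff, moment_id_eq]
  rw [Measure.conv, integral_map (by fun_prop) (by fun_prop)]
  simp_rw [add_pow]
  rw [integral_finsetSum _ hint, Finset.mul_sum]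
  refine Finset.sum_congr rfl fun i hi => ?_
  have hik := Finset.mem_range_succ_iff.1 hi
  -- The factor `1 / k!` cancels the numerator of the binomial coefficient, leaving a Cauchy
  -- product.
  rw [integral_mul_const, integral_prod_mul (fun x : ℝ => x ^ i) fun x : ℝ => x ^ (k - i),
    Nat.cast_choose ℝ hik]
  have hpow : (-1 : ℝ) ^ k = (-1) ^ i * (-1) ^ (k - i) := by
    rw [← pow_add]; congr 1; omega
  rw [hpow]
  have := Nat.factorial_ne_zero k
  field_simp

end

/-! ### Expansion of half-convolutions with weighted errors -/

/-- Uniform estimates for a survival function `T` with hazard rate `h`, in terms of a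
submultiplicative weight `W`, that allow one to expand tails of convolutions. -/
structure ExpansionControl (T h W : ℝ → ℝ) (m : ℕ) (t₁ A : ℝ) : Prop where
  antitone : Antitone T
  pos : ∀ t, 0 < T t
  le_one : ∀ t, T t ≤ 1
  one_le : 1 ≤ t₁
  one_le_const : 1 ≤ A
  hazard_pos : ∀ t, t₁ ≤ t → 0 < h t
  hazard_le_one : ∀ t, t₁ ≤ t → h t ≤ 1
  measurable_weight : Measurable W
  one_le_weight : ∀ x, 1 ≤ W x
  weight_add_le : ∀ x y, 0 ≤ x → 0 ≤ y → W (x + y) ≤ A * (W x * W y)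
  pow_le_weight : ∀ i ≤ m, ∀ x, 0 ≤ x → x ^ i ≤ A * W x
  sq_half_le : ∀ t, 2 * t₁ ≤ t → T (t / 2) * T (t / 2) ≤ A * (h t ^ (m + 1) * T t)
  sub_le : ∀ t x, 2 * t₁ ≤ t → 0 ≤ x → x ≤ t / 2 →
    h (t - x) ^ (m + 1) * T (t - x) ≤ A * (h t ^ (m + 1) * T t) * W x
  abs_iteratedDeriv_le : ∀ i ≤ m, ∀ t, t₁ ≤ t → |iteratedDeriv i T t| ≤ A * T t
  one_le_mul : ∀ t, t₁ ≤ t → t ≤ 2 * t₁ → 1 ≤ A * (h t ^ (m + 1) * T t)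
  taylor : ∀ i ≤ m, ∀ t x, 2 * t₁ ≤ t → 0 ≤ x →
    |(Set.Iic (t / 2)).indicator (fun x => iteratedDeriv i T (t - x)) x -
      ∑ j ∈ Finset.range (m - i + 1), (-x) ^ j / j.factorial * iteratedDeriv (i + j) T t| ≤
    A * (h t ^ (m + 1) * T t) * W x

/-- A sum of constants dominates each of them. The term `R₁⁻¹` serves `[t₁, 2 t₁]`, where `h^(m+1)
T` is at least its value `R₁` at the right end. -/
theorem TailControl.exists_expansionControl {T h : ℝ → ℝ} {m : ℕ} {t₁ q K : ℝ}
    (c : TailControl T h m t₁ q K) :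
    ∃ A, ExpansionControl T h (fun x => T x ^ (-((1 + q) / 2))) m t₁ A := by
  obtain ⟨A₁, hA₁, hA₁b⟩ := c.exists_mul_le_add
  obtain ⟨A₂, hA₂, hA₂b⟩ := c.exists_pow_mul_rpow_le_weight m
  obtain ⟨A₃, hA₃, hA₃b⟩ := c.exists_sq_half_le
  obtain ⟨A₄, hA₄, hA₄b⟩ := c.exists_hazard_pow_mul_sub_le
  obtain ⟨A₅, hA₅, hA₅b⟩ := c.exists_abs_indicator_sub_taylor_le
  have hK := c.K_pos
  have hq := c.q_pos
  have ht₁ := c.one_le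
  have hR₁ : 0 < h (2 * t₁) ^ (m + 1) * T (2 * t₁) :=
    mul_pos (pow_pos (c.hazard_pos _ (by linarith)) _) (c.pos _)
  set R₁ := h (2 * t₁) ^ (m + 1) * T (2 * t₁)
  have hp₁ := Real.rpow_pos_of_pos hA₁ ((1 + q) / 2)
  set A₁' := A₁ ^ ((1 + q) / 2)
  have hR : ∀ t, t₁ ≤ t → 0 < h t ^ (m + 1) * T t := fun t ht =>
    mul_pos (pow_pos (c.hazard_pos _ ht) _) (c.pos _)
  have hW0 : ∀ x, 0 < T x ^ (-((1 + q) / 2)) := fun x => Real.rpow_pos_of_pos (c.pos x) _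
  have hinv : 0 < R₁⁻¹ := inv_pos.2 hR₁
  refine ⟨1 + A₁' + A₂ + A₃ + A₄ + A₅ + K + R₁⁻¹, ?_⟩
  set A := 1 + A₁' + A₂ + A₃ + A₄ + A₅ + K + R₁⁻¹ with hA
  exact
    { antitone := c.antitone
      pos := c.pos
      le_one := c.le_one
      one_le := c.one_le
      one_le_const := by linarith
      hazard_pos := c.hazard_pos
      hazard_le_one := c.hazard_le_one
      measurable_weight := c.antitone.measurable.pow_const _
      one_le_weight := c.one_le_rpow_neg (by linarith)
      weight_add_le := fun x y hx hy => by
        have h1 := hA₁b x y hx hy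
        have p1 := c.pos x
        have p2 := c.pos y
        have p3 := c.pos (x + y)
        have h2 : T x ^ ((1 + q) / 2) * T y ^ ((1 + q) / 2) ≤ A₁' * T (x + y) ^ ((1 + q) / 2) := by
          rw [← Real.mul_rpow p1.le p2.le, ← Real.mul_rpow hA₁.le p3.le]
          exact Real.rpow_le_rpow (by positivity) h1 (by positivity)
        have q1 := Real.rpow_pos_of_pos p1 ((1 + q) / 2)
        have q2 := Real.rpow_pos_of_pos p2 ((1 + q) / 2)
        have q3 := Real.rpow_pos_of_pos p3 ((1 + q) / 2)
        have h3 : T x ^ ((1 + q) / 2) * T y ^ ((1 + q) / 2) ≤ A * T (x + y) ^ ((1 + q) / 2) :=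
          h2.trans (by gcongr; linarith)
        rw [Real.rpow_neg p1.le, Real.rpow_neg p2.le, Real.rpow_neg p3.le, ← mul_inv,
          ← div_eq_mul_inv, le_div_iff₀ (by positivity), inv_mul_le_iff₀ q3]
        linarith
      pow_le_weight := fun i hi x hx => by
        have h1 := hA₂b i hi x hx
        have h2 := le_mul_of_one_le_right (pow_nonneg hx i) (c.one_le_rpow_neg hq.le x)
        refine h2.trans (h1.trans ?_)
        have := hW0 x
        gcongr
        linarith
      sq_half_le := fun t ht => by
        have := hR t (by linarith)
        refine (hA₃b t ht).trans ?_
        gcongr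
        linarith
      sub_le := fun t x ht hx hxt => by
        have h0 := hR t (by linarith)
        have h1 := hA₄b t x (t - x) ht (by linarith) le_rfl (by linarith)
        have h2 : T x ^ (-q) ≤ T x ^ (-((1 + q) / 2)) :=
          Real.rpow_le_rpow_of_exponent_ge (c.pos x) (c.le_one x) (by linarith [c.q_lt_one])
        have h3 := Real.rpow_pos_of_pos (c.pos x) (-q)
        refine h1.trans ?_
        gcongr
        linarith
      abs_iteratedDeriv_le := fun i hi t ht => by
        have h1 := c.pos t
        have h2 : h t ^ i ≤ 1 := pow_le_one₀ (c.hazard_pos t ht).le (c.hazard_le_one t ht)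
        calc |iteratedDeriv i T t| ≤ K * (h t ^ i * T t) :=
              c.abs_iteratedDeriv_le i (by omega) t ht
          _ ≤ K * (1 * T t) := by gcongr
          _ ≤ A * T t := by rw [one_mul]; gcongr; linarith
      one_le_mul := fun t ht ht2 => by
        have h1 : R₁ ≤ h t ^ (m + 1) * T t := by
          have a1 := c.hazard_antitone ht (show t₁ ≤ 2 * t₁ by linarith) ht2
          have a2 := c.hazard_pos (2 * t₁) (by linarith)
          have a3 := c.pos (2 * t₁)
          have a4 := c.antitone ht2
          have a5 := c.hazard_pos t ht
          simp only [R₁]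
          gcongr
        have h2 := hR t ht
        calc 1 = R₁⁻¹ * R₁ := (inv_mul_cancel₀ hR₁.ne').symm
          _ ≤ A * (h t ^ (m + 1) * T t) := by
            gcongr
            linarith
      taylor := fun i hi t x ht hx => by
        have h0 := hR t (by linarith)
        have := hW0 x
        refine (hA₅b i hi t x ht hx).trans ?_
        gcongr
        linarith }

namespace ExpansionControl

variable {T h W : ℝ → ℝ} {m : ℕ} {t₁ A : ℝ}

lemma rate_pos (c : ExpansionControl T h W m t₁ A) {t : ℝ} (ht : t₁ ≤ t) :
    0 < h t ^ (m + 1) * T t :=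
  mul_pos (pow_pos (c.hazard_pos t ht) _) (c.pos t)

lemma weight_pos (c : ExpansionControl T h W m t₁ A) (x : ℝ) : 0 < W x :=
  zero_lt_one.trans_le (c.one_le_weight x)

lemma one_le_integral_weight (c : ExpansionControl T h W m t₁ A) {H : Measure ℝ}
    [IsProbabilityMeasure H] (hW : Integrable W H) : 1 ≤ ∫ x, W x ∂H := by
  have := integral_mono (integrable_const (1 : ℝ)) hW c.one_le_weight
  simpa using this

lemma integrable_pow (c : ExpansionControl T h W m t₁ A) {H : Measure ℝ}
    (hH : H (Set.Iio 0) = 0) (hW : Integrable W H) {i : ℕ} (hi : i ≤ m) :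
    Integrable (fun x : ℝ => x ^ i) H := by
  refine (hW.const_mul A).mono' (by fun_prop) ?_
  filter_upwards [ae_nonneg_of_Iio hH] with x hx
  rw [Real.norm_eq_abs, abs_of_nonneg (by positivity)]
  exact c.pow_le_weight i hi x hx

lemma integral_abs_pow_le (c : ExpansionControl T h W m t₁ A) {H : Measure ℝ}
    (hH : H (Set.Iio 0) = 0) (hW : Integrable W H) {i : ℕ} (hi : i ≤ m) :
    ∫ x, |x ^ i| ∂H ≤ A * ∫ x, W x ∂H := by
  rw [← integral_const_mul]
  refine integral_mono_ae (c.integrable_pow hH hW hi).abs (hW.const_mul A) ?_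
  filter_upwards [ae_nonneg_of_Iio hH] with x hx
  rw [abs_of_nonneg (by positivity)]
  exact c.pow_le_weight i hi x hx

lemma abs_laplaceCoeff_le (c : ExpansionControl T h W m t₁ A) {H : Measure ℝ}
    (hH : H (Set.Iio 0) = 0) (hW : Integrable W H) {i : ℕ} (hi : i ≤ m) :
    |laplaceCoeff H i| ≤ A * ∫ x, W x ∂H := by
  have h1 : |∫ x, x ^ i ∂H| ≤ A * ∫ x, W x ∂H :=
    abs_integral_le_integral_abs.trans (c.integral_abs_pow_le hH hW hi)
  rw [laplaceCoeff, moment_id_eq, abs_mul, abs_div, abs_pow, abs_neg, abs_one, one_pow,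
    Nat.abs_cast]
  refine le_trans (mul_le_of_le_one_left (abs_nonneg _) ?_) h1
  rw [div_le_one (by exact_mod_cast Nat.factorial_pos i)]
  exact_mod_cast Nat.factorial_pos i

lemma abs_laplaceApply_le (c : ExpansionControl T h W m t₁ A) {H : Measure ℝ}
    (hH : H (Set.Iio 0) = 0) (hW : Integrable W H) {t : ℝ} (ht : t₁ ≤ t) :
    |laplaceApply H m T t| ≤ (m + 1) * (A * (∫ x, W x ∂H) * (A * T t)) := by
  rw [laplaceApply]
  refine (Finset.abs_sum_le_sum_abs _ _).trans
    ((Finset.sum_le_card_nsmul _ _ (A * (∫ x, W x ∂H) * (A * T t)) fun i hi => ?_).trans ?_)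
  · have hi' := Finset.mem_range_succ_iff.1 hi
    rw [abs_mul]
    have := c.abs_laplaceCoeff_le hH hW hi'
    exact mul_le_mul this (c.abs_iteratedDeriv_le i hi' t ht) (abs_nonneg _)
      ((abs_nonneg _).trans this)
  · simp

lemma weight_conv (c : ExpansionControl T h W m t₁ A) {μ ν : Measure ℝ} [IsProbabilityMeasure μ]
    [IsProbabilityMeasure ν] (hμ : μ (Set.Iio 0) = 0) (hν : ν (Set.Iio 0) = 0)
    (hWμ : Integrable W μ) (hWν : Integrable W ν) :
    Integrable W (μ.conv ν) ∧
      ∫ x, W x ∂(μ.conv ν) ≤ A * ((∫ x, W x ∂μ) * ∫ x, W x ∂ν) := by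
  have hp : Integrable (fun p : ℝ × ℝ => A * (W p.1 * W p.2)) (μ.prod ν) :=
    (hWμ.mul_prod hWν).const_mul A
  have hle : ∀ᵐ p ∂(μ.prod ν), W (p.1 + p.2) ≤ A * (W p.1 * W p.2) := by
    filter_upwards [ae_prod_nonneg hμ hν] with p hp
    exact c.weight_add_le _ _ hp.1 hp.2
  have hi : Integrable (fun p : ℝ × ℝ => W (p.1 + p.2)) (μ.prod ν) := by
    refine hp.mono' (c.measurable_weight.comp (by fun_prop)).aestronglyMeasurable ?_
    filter_upwards [hle] with p hp
    rwa [Real.norm_eq_abs, abs_of_pos (c.weight_pos _)]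
  rw [Measure.conv]
  refine ⟨(integrable_map_measure c.measurable_weight.aestronglyMeasurable (by fun_prop)).2 hi, ?_⟩
  rw [integral_map (by fun_prop) c.measurable_weight.aestronglyMeasurable,
    ← integral_prod_mul W W, ← integral_const_mul]
  exact integral_mono_ae hi hp hle

lemma measurable_iteratedDeriv (c : ExpansionControl T h W m t₁ A) (i : ℕ) :
    Measurable (iteratedDeriv i T) := by
  cases i with
  | zero => simpa using c.antitone.measurable
  | succ i => rw [iteratedDeriv_succ]; exact measurable_deriv _

lemma integrable_taylor {H : Measure ℝ} (hint : ∀ i ≤ m, Integrable (fun x : ℝ => x ^ i) H)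
    {i : ℕ} (t : ℝ) :
    Integrable (fun x => ∑ j ∈ Finset.range (m - i + 1),
      (-x) ^ j / j.factorial * iteratedDeriv (i + j) T t) H := by
  refine integrable_finsetSum _ fun j hj => ?_
  have hj' := Finset.mem_range_succ_iff.1 hj
  have := (hint j (by omega)).const_mul ((-1) ^ j / j.factorial * iteratedDeriv (i + j) T t)
  refine this.congr (ae_of_all _ fun x => ?_)
  simp only
  rw [neg_pow x]; ring

lemma integral_taylor {H : Measure ℝ} (hint : ∀ i ≤ m, Integrable (fun x : ℝ => x ^ i) H)
    {i : ℕ} (t : ℝ) :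
    ∫ x, ∑ j ∈ Finset.range (m - i + 1), (-x) ^ j / j.factorial * iteratedDeriv (i + j) T t ∂H =
      ∑ j ∈ Finset.range (m - i + 1), laplaceCoeff H j * iteratedDeriv (i + j) T t := by
  have heq : ∀ (j : ℕ) (x : ℝ), (-x) ^ j / j.factorial * iteratedDeriv (i + j) T t =
      (-1) ^ j / j.factorial * iteratedDeriv (i + j) T t * x ^ j := fun j x => by
    rw [neg_pow x]; ring
  rw [integral_congr_ae (ae_of_all _ fun x => Finset.sum_congr rfl fun j _ => heq j x)]
  rw [integral_finsetSum _ fun j hj => (hint j (by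
    have := Finset.mem_range_succ_iff.1 hj; omega)).const_mul _]
  refine Finset.sum_congr rfl fun j _ => ?_
  rw [integral_const_mul, laplaceCoeff, moment_id_eq]; ring

lemma integrable_indicator (c : ExpansionControl T h W m t₁ A) {H : Measure ℝ}
    (hH : H (Set.Iio 0) = 0) (hW : Integrable W H) {i : ℕ} (hi : i ≤ m) {t : ℝ}
    (ht : 2 * t₁ ≤ t) :
    Integrable ((Set.Iic (t / 2)).indicator fun x => iteratedDeriv i T (t - x)) H := by
  have h1 := integrable_taylor (T := T) (fun j hj => c.integrable_pow hH hW (i := j) hj)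
    (i := i) t
  refine (h1.abs.add (hW.const_mul (A * (h t ^ (m + 1) * T t)))).mono'
    (((c.measurable_iteratedDeriv i).comp (by fun_prop)).indicator
      measurableSet_Iic).aestronglyMeasurable ?_
  filter_upwards [ae_nonneg_of_Iio hH] with x hx
  have h2 := c.taylor i hi t x ht hx
  rw [Real.norm_eq_abs]
  simp only [Pi.add_apply]
  linarith [abs_sub_abs_le_abs_sub
    ((Set.Iic (t / 2)).indicator (fun x => iteratedDeriv i T (t - x)) x)
    (∑ j ∈ Finset.range (m - i + 1), (-x) ^ j / j.factorial * iteratedDeriv (i + j) T t)]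

/-- Integrating the Taylor bound turns `(-x)^j / j!` into Laplace coefficients. Stopping at total
order `m` is what later produces products truncated at `D^(m+1)`. -/
lemma abs_halfConv_iteratedDeriv_sub_le (c : ExpansionControl T h W m t₁ A) {H : Measure ℝ}
    (hH : H (Set.Iio 0) = 0) (hW : Integrable W H) {i : ℕ} (hi : i ≤ m) {t : ℝ}
    (ht : 2 * t₁ ≤ t) :
    |halfConv (iteratedDeriv i T) H t -
      ∑ j ∈ Finset.range (m - i + 1), laplaceCoeff H j * iteratedDeriv (i + j) T t| ≤
      A * (h t ^ (m + 1) * T t) * ∫ x, W x ∂H := by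
  have hint := fun j (hj : j ≤ m) => c.integrable_pow hH hW (i := j) hj
  rw [halfConv, ← integral_taylor hint, ← integral_sub (c.integrable_indicator hH hW hi ht)
    (integrable_taylor hint t), ← integral_const_mul]
  refine abs_integral_le_integral_abs.trans (integral_mono_ae
    ((c.integrable_indicator hH hW hi ht).sub (integrable_taylor hint t)).abs
    (hW.const_mul _) ?_)
  filter_upwards [ae_nonneg_of_Iio hH] with x hx
  exact c.taylor i hi t x ht hx

lemma abs_halfConv_sub_laplaceApply_le (c : ExpansionControl T h W m t₁ A) {H : Measure ℝ}
    (hH : H (Set.Iio 0) = 0) (hW : Integrable W H) {t : ℝ} (ht : 2 * t₁ ≤ t) :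
    |halfConv T H t - laplaceApply H m T t| ≤
      A * (h t ^ (m + 1) * T t) * ∫ x, W x ∂H := by
  simpa [laplaceApply] using c.abs_halfConv_iteratedDeriv_sub_le hH hW (Nat.zero_le m) ht

lemma halfConv_laplaceApply (c : ExpansionControl T h W m t₁ A) (μ : Measure ℝ) {H : Measure ℝ}
    (hH : H (Set.Iio 0) = 0) (hW : Integrable W H) {t : ℝ} (ht : 2 * t₁ ≤ t) :
    Integrable ((Set.Iic (t / 2)).indicator fun x => laplaceApply μ m T (t - x)) H ∧
    halfConv (laplaceApply μ m T) H t =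
      ∑ i ∈ Finset.range (m + 1), laplaceCoeff μ i * halfConv (iteratedDeriv i T) H t := by
  have heq : (Set.Iic (t / 2)).indicator (fun x => laplaceApply μ m T (t - x)) =
      fun x => ∑ i ∈ Finset.range (m + 1), laplaceCoeff μ i *
        (Set.Iic (t / 2)).indicator (fun x => iteratedDeriv i T (t - x)) x := by
    funext x
    by_cases hx : x ∈ Set.Iic (t / 2)
    · simp [Set.indicator_of_mem hx, laplaceApply]
    · simp [Set.indicator_of_notMem hx]
  have hi : ∀ i ∈ Finset.range (m + 1), Integrable (fun x => laplaceCoeff μ i *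
      (Set.Iic (t / 2)).indicator (fun x => iteratedDeriv i T (t - x)) x) H := fun i hi =>
    (c.integrable_indicator hH hW (Finset.mem_range_succ_iff.1 hi) ht).const_mul _
  refine ⟨heq ▸ integrable_finsetSum _ hi, ?_⟩
  rw [halfConv, heq, integral_finsetSum _ hi]
  simp_rw [integral_const_mul]
  rfl

/-- Each derivative in `L_μ T` is expanded under `H`. The double sum over `i + j ≤ m`, taken along
diagonals, is the character of the convolution by `laplaceCoeff_conv`. -/
lemma abs_halfConv_laplaceApply_sub_le (c : ExpansionControl T h W m t₁ A) {μ H : Measure ℝ}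
    [IsProbabilityMeasure μ] [IsProbabilityMeasure H]
    (hμ : μ (Set.Iio 0) = 0) (hWμ : Integrable W μ)
    (hH : H (Set.Iio 0) = 0) (hW : Integrable W H) {t : ℝ} (ht : 2 * t₁ ≤ t) :
    |halfConv (laplaceApply μ m T) H t - laplaceApply (μ.conv H) m T t| ≤
      (m + 1) * (A * (∫ x, W x ∂μ) * (A * (h t ^ (m + 1) * T t) * ∫ x, W x ∂H)) := by
  have hconv : laplaceApply (μ.conv H) m T t = ∑ i ∈ Finset.range (m + 1), laplaceCoeff μ i *
      ∑ j ∈ Finset.range (m - i + 1), laplaceCoeff H j * iteratedDeriv (i + j) T t := by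
    have h1 : ∀ k ∈ Finset.range (m + 1), laplaceCoeff (μ.conv H) k * iteratedDeriv k T t =
        ∑ i ∈ Finset.range (k + 1), laplaceCoeff μ i *
          (laplaceCoeff H (k - i) * iteratedDeriv (i + (k - i)) T t) := by
      intro k hk
      have hk' := Finset.mem_range_succ_iff.1 hk
      rw [laplaceCoeff_conv (fun i hi => c.integrable_pow hμ hWμ (hi.trans hk'))
        (fun i hi => c.integrable_pow hH hW (hi.trans hk')), Finset.sum_mul]
      refine Finset.sum_congr rfl fun i hi => ?_
      rw [Nat.add_sub_cancel' (Finset.mem_range_succ_iff.1 hi), mul_assoc]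
    rw [laplaceApply, Finset.sum_congr rfl h1, Finset.sum_range_diag_flip (m + 1)
      fun i j => laplaceCoeff μ i * (laplaceCoeff H j * iteratedDeriv (i + j) T t)]
    refine Finset.sum_congr rfl fun i hi => ?_
    rw [Finset.mul_sum, Nat.sub_add_comm (Finset.mem_range_succ_iff.1 hi)]
  rw [(c.halfConv_laplaceApply μ hH hW ht).2, hconv, ← Finset.sum_sub_distrib]
  refine (Finset.abs_sum_le_sum_abs _ _).trans ((Finset.sum_le_card_nsmul _ _
    (A * (∫ x, W x ∂μ) * (A * (h t ^ (m + 1) * T t) * ∫ x, W x ∂H)) fun i hi => ?_).trans ?_)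
  · have hi' := Finset.mem_range_succ_iff.1 hi
    rw [← mul_sub, abs_mul]
    have h1 := c.abs_laplaceCoeff_le hμ hWμ hi'
    exact mul_le_mul h1 (c.abs_halfConv_iteratedDeriv_sub_le hH hW hi' ht) (abs_nonneg _)
      ((abs_nonneg _).trans h1)
  · simp

end ExpansionControl

/-! ### Induction on convolution powers -/

namespace ExpansionControl

variable {h W : ℝ → ℝ} {m : ℕ} {t₁ A : ℝ}

/-- The part of the convolution carried by `x ≤ t / 2` preserves bounds by `h ^ (m + 1) * T`. -/
lemma abs_halfConv_le {T : ℝ → ℝ} (c : ExpansionControl T h W m t₁ A) {H : Measure ℝ}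
    (hH : H (Set.Iio 0) = 0) (hW : Integrable W H) {f : ℝ → ℝ} {M : ℝ} (hM : 0 ≤ M)
    (hf : ∀ t, t₁ ≤ t → |f t| ≤ M * (h t ^ (m + 1) * T t)) {t : ℝ} (ht : 2 * t₁ ≤ t) :
    |halfConv f H t| ≤ M * (A * (h t ^ (m + 1) * T t) * ∫ x, W x ∂H) := by
  have hR := c.rate_pos (show t₁ ≤ t by linarith [c.one_le])
  have hA : 0 < A := by linarith [c.one_le_const]
  rw [halfConv, ← Real.norm_eq_abs, ← integral_const_mul, ← integral_const_mul]
  refine norm_integral_le_of_norm_le ((hW.const_mul _).const_mul _) ?_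
  filter_upwards [ae_nonneg_of_Iio hH] with x hx
  have hW0 := c.weight_pos x
  by_cases hxt : x ∈ Set.Iic (t / 2)
  · rw [Set.indicator_of_mem hxt, Real.norm_eq_abs]
    have hxt' : x ≤ t / 2 := hxt
    exact (hf (t - x) (by linarith)).trans
      (mul_le_mul_of_nonneg_left (c.sub_le t x ht hx hxt') hM)
  · rw [Set.indicator_of_notMem hxt, norm_zero]
    positivity

/-- Propagation of the expansion of the tail of `F^{*(n+1)}` to `F^{*(n+2)}`. -/
lemma abs_tail_conv_sub_le {F : Measure ℝ} [IsProbabilityMeasure F]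
    (c : ExpansionControl (tail F) h W m t₁ A) (hF : F (Set.Iio 0) = 0) (hWF : Integrable W F)
    {H : Measure ℝ} [IsProbabilityMeasure H] (hH : H (Set.Iio 0) = 0) (hWH : Integrable W H)
    {k M : ℝ} (hk : 0 ≤ k) (hM : 0 ≤ M)
    (hE : ∀ t, t₁ ≤ t → |tail (H.conv F) t - k * laplaceApply H m (tail F) t| ≤
      M * (h t ^ (m + 1) * tail F t)) {t : ℝ} (ht : t₁ ≤ t) :
    |tail ((H.conv F).conv F) t - (k + 1) * laplaceApply (H.conv F) m (tail F) t| ≤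
      4 * ((m + 1) * (A * A * A * A) * ∫ x, W x ∂F) * (M + (k + 1) * ∫ x, W x ∂H) *
        (h t ^ (m + 1) * tail F t) := by
  set μ := H.conv F with hμ
  have hμp : IsProbabilityMeasure μ := Measure.probabilitymeasure_of_probabilitymeasures_conv _ _
  have hμ0 : μ (Set.Iio 0) = 0 := conv_Iio_zero hH hF
  obtain ⟨hWμ, hwμ⟩ := c.weight_conv hH hF hWH hWF
  rw [← hμ] at hWμ hwμ
  have hw := c.one_le_integral_weight hWF
  have hwH := c.one_le_integral_weight hWH
  have hwμ0 := c.one_le_integral_weight hWμ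
  set w := ∫ x, W x ∂F
  set v := ∫ x, W x ∂H
  set u := ∫ x, W x ∂μ
  have hA := c.one_le_const
  have hA0 : 0 < A := by linarith
  have hR := c.rate_pos ht
  set R := h t ^ (m + 1) * tail F t with hRdef
  set b : ℝ := (m + 1) * (A * A * A * A) * w with hb
  have hm1 : (1 : ℝ) ≤ m + 1 := by linarith [(Nat.cast_nonneg m : (0 : ℝ) ≤ m)]
  have hw0 : 0 < w := by linarith
  have hv0 : 0 < v := by linarith
  have hb1 : ∀ x y z : ℝ, 0 ≤ x → x ≤ m + 1 → 0 ≤ y → y ≤ A * A * A * A → 0 ≤ z → z ≤ w →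
      x * y * z ≤ b := fun x y z hx0 hx hy0 hy hz0 hz => by rw [hb]; gcongr
  have hAA : A ≤ A * A * A * A := by
    have h1 : 1 ≤ A * A * A := one_le_mul_of_one_le_of_one_le
      (one_le_mul_of_one_le_of_one_le hA hA) hA
    nlinarith
  have hAA2 : A * A ≤ A * A * A * A := by
    have h1 : 1 ≤ A * A := one_le_mul_of_one_le_of_one_le hA hA
    nlinarith
  have hAA3 : A * A * A ≤ A * A * A * A := le_mul_of_one_le_right (by positivity) hA
  have hb0 : 0 < b := by positivity
  -- On `[t₁, 2 t₁]` the rate satisfies `A * R ≥ 1`, so crude bounds suffice. The expansions are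
  -- used only beyond `2 t₁`.
  rcases le_total t (2 * t₁) with ht2 | ht2
  · have h1 := c.abs_laplaceApply_le hμ0 hWμ ht
    have h2 := c.one_le_mul t ht ht2
    rw [← hRdef] at h2
    have h3 : |tail (μ.conv F) t| ≤ 1 := by
      rw [abs_of_nonneg (tail_nonneg _ _)]; exact tail_le_one _ _
    have h4 := c.le_one t
    have h5 := c.pos t
    have h6 : (m + 1) * (A * u * (A * tail F t)) ≤ b * v * R := by
      calc (m + 1) * (A * u * (A * tail F t)) ≤ (m + 1) * (A * (A * (v * w)) * (A * 1)) := by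
            gcongr
        _ = (m + 1) * (A * A * A) * w * v * 1 := by ring
        _ ≤ (m + 1) * (A * A * A) * w * v * (A * R) := by gcongr
        _ = b * v * R := by rw [hb]; ring
    have h7 : 1 ≤ b * v * R := by
      calc 1 ≤ A * R := h2
        _ = 1 * A * 1 * 1 * R := by ring
        _ ≤ b * v * R := by
          have := hb1 1 A 1 zero_le_one hm1 hA0.le hAA zero_le_one hw
          gcongr
    calc |tail (μ.conv F) t - (k + 1) * laplaceApply μ m (tail F) t|
        ≤ |tail (μ.conv F) t| + (k + 1) * |laplaceApply μ m (tail F) t| := by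
          refine (abs_sub _ _).trans ?_
          rw [abs_mul, abs_of_nonneg (by linarith : 0 ≤ k + 1)]
      _ ≤ b * v * R + (k + 1) * (b * v * R) := by gcongr <;> linarith
      _ ≤ 4 * b * (M + (k + 1) * v) * R := by
          have e1 : 0 ≤ b * M * R := by positivity
          have e2 : 0 ≤ b * v * R := by positivity
          have e3 : 0 ≤ k * (b * v * R) := by positivity
          have e4 : 4 * b * (M + (k + 1) * v) * R =
            4 * (b * M * R) + 4 * (k * (b * v * R)) + 4 * (b * v * R) := by ring
          linarith
  · have hsplit := tail_conv μ F t
    set E : ℝ → ℝ := fun s => tail μ s - k * laplaceApply H m (tail F) s with hEdef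
    obtain ⟨hLi, -⟩ := c.halfConv_laplaceApply H hF hWF ht2
    have hTi : Integrable ((Set.Iic (t / 2)).indicator fun x => tail μ (t - x)) F := by
      refine (integrable_const (1 : ℝ)).mono' (((tail_antitone μ).measurable.comp
        (by fun_prop)).indicator measurableSet_Iic).aestronglyMeasurable (ae_of_all _ fun x => ?_)
      by_cases hx : x ∈ Set.Iic (t / 2)
      · rw [Set.indicator_of_mem hx, Real.norm_eq_abs, abs_of_nonneg (tail_nonneg _ _)]
        exact tail_le_one _ _
      · rw [Set.indicator_of_notMem hx, norm_zero]; exact zero_le_one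
    -- The error `E` stays of the same order, and `k L_H T` becomes `k L_μ T`. The other
    -- half-convolution adds one more `L_μ T`, whence the factor `k + 1`.
    have hEconv : halfConv (tail μ) F t =
        halfConv E F t + k * halfConv (laplaceApply H m (tail F)) F t := by
      have heq : (Set.Iic (t / 2)).indicator (fun x => E (t - x)) = fun x =>
          (Set.Iic (t / 2)).indicator (fun x => tail μ (t - x)) x -
          k * (Set.Iic (t / 2)).indicator (fun x => laplaceApply H m (tail F) (t - x)) x := by
        funext x
        by_cases hx : x ∈ Set.Iic (t / 2)
        · simp [Set.indicator_of_mem hx, hEdef]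
        · simp [Set.indicator_of_notMem hx]
      simp only [halfConv, heq]
      rw [integral_sub hTi (hLi.const_mul k), integral_const_mul]
      ring
    have e1 := c.abs_halfConv_le hF hWF hM hE ht2
    have e2 := c.abs_halfConv_laplaceApply_sub_le hH hWH hF hWF ht2
    have e3 := c.abs_halfConv_sub_laplaceApply_le hμ0 hWμ ht2
    rw [← hRdef] at e1 e2 e3
    rw [← hμ] at e2
    have ht3 : t₁ ≤ t / 2 := by linarith
    have e4 : tail μ (t / 2) * tail F (t / 2) ≤
        (k * ((m + 1) * (A * v * A)) + M) * (A * R) := by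
      have a1 := hE (t / 2) ht3
      have a2 := c.abs_laplaceApply_le hH hWH ht3
      have a3 := c.pos (t / 2)
      have a4 : h (t / 2) ^ (m + 1) ≤ 1 :=
        pow_le_one₀ (c.hazard_pos _ ht3).le (c.hazard_le_one _ ht3)
      have a5 := c.sq_half_le t ht2
      have a6 : tail μ (t / 2) ≤ (k * ((m + 1) * (A * v * A)) + M) * tail F (t / 2) := by
        have b1 := (abs_le.1 a1).2
        have b2 : k * laplaceApply H m (tail F) (t / 2) ≤
            k * ((m + 1) * (A * v * (A * tail F (t / 2)))) :=
          mul_le_mul_of_nonneg_left ((le_abs_self _).trans a2) hk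
        have b3 : M * (h (t / 2) ^ (m + 1) * tail F (t / 2)) ≤ M * (1 * tail F (t / 2)) := by
          gcongr
        linarith
      calc tail μ (t / 2) * tail F (t / 2)
          ≤ (k * ((m + 1) * (A * v * A)) + M) * tail F (t / 2) * tail F (t / 2) := by gcongr
        _ = (k * ((m + 1) * (A * v * A)) + M) * (tail F (t / 2) * tail F (t / 2)) := by ring
        _ ≤ _ := by gcongr
    have e4' : |tail μ (t / 2) * tail F (t / 2)| ≤
        (k * ((m + 1) * (A * v * A)) + M) * (A * R) := by
      rwa [abs_of_nonneg (mul_nonneg (tail_nonneg _ _) (tail_nonneg _ _))]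
    have f1 : M * (A * R * w) ≤ b * M * R := by
      calc M * (A * R * w) = (1 * A * w) * M * R := by ring
        _ ≤ b * M * R := by
          have := hb1 1 A w zero_le_one hm1 hA0.le hAA hw0.le le_rfl
          gcongr
    have f2 : (m + 1) * (A * v * (A * R * w)) ≤ b * v * R := by
      calc (m + 1) * (A * v * (A * R * w)) = ((m + 1) * (A * A) * w) * v * R := by ring
        _ ≤ b * v * R := by
          have := hb1 (m + 1) (A * A) w (by positivity) le_rfl (by positivity) hAA2 hw0.le le_rfl
          gcongr
    have f3 : A * R * u ≤ b * v * R := by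
      calc A * R * u ≤ A * R * (A * (v * w)) := by gcongr
        _ = (1 * (A * A) * w) * v * R := by ring
        _ ≤ b * v * R := by
          have := hb1 1 (A * A) w zero_le_one hm1 (by positivity) hAA2 hw0.le le_rfl
          gcongr
    have f4 : (k * ((m + 1) * (A * v * A)) + M) * (A * R) ≤ k * (b * v * R) + b * M * R := by
      have g1 := hb1 (m + 1) (A * A * A) 1 (by positivity) le_rfl (by positivity) hAA3
        zero_le_one hw
      have g2 := hb1 1 A 1 zero_le_one hm1 hA0.le hAA zero_le_one hw
      calc (k * ((m + 1) * (A * v * A)) + M) * (A * R)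
          = k * (((m + 1) * (A * A * A) * 1) * v * R) + (1 * A * 1) * M * R := by ring
        _ ≤ k * (b * v * R) + b * M * R := by gcongr
    have hdecomp : tail (μ.conv F) t - (k + 1) * laplaceApply μ m (tail F) t =
        halfConv E F t + k * (halfConv (laplaceApply H m (tail F)) F t -
          laplaceApply μ m (tail F) t) + (halfConv (tail F) μ t - laplaceApply μ m (tail F) t) +
          tail μ (t / 2) * tail F (t / 2) := by
      rw [hsplit, hEconv]; ring
    have e2' : |k * (halfConv (laplaceApply H m (tail F)) F t - laplaceApply μ m (tail F) t)| ≤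
        k * (b * v * R) := by
      rw [abs_mul, abs_of_nonneg hk]
      exact mul_le_mul_of_nonneg_left (e2.trans f2) hk
    have h_abs : ∀ x y z s : ℝ, |x + y + z + s| ≤ |x| + |y| + |z| + |s| := fun x y z s => by
      have := abs_add_le (x + y + z) s
      have := abs_add_three x y z
      linarith
    rw [hdecomp]
    calc _ ≤ |halfConv E F t| + |k * (halfConv (laplaceApply H m (tail F)) F t -
          laplaceApply μ m (tail F) t)| + |halfConv (tail F) μ t - laplaceApply μ m (tail F) t| +
          |tail μ (t / 2) * tail F (t / 2)| :=
            h_abs _ _ _ _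
      _ ≤ b * M * R + k * (b * v * R) + b * v * R + (k * (b * v * R) + b * M * R) :=
          add_le_add (add_le_add (add_le_add (e1.trans f1) e2') (e3.trans f3))
            (e4'.trans f4)
      _ ≤ 4 * b * (M + (k + 1) * v) * R := by
          have e1 : 0 ≤ b * M * R := by positivity
          have e2 : 0 ≤ b * v * R := by positivity
          have e3 : 0 ≤ k * (b * v * R) := by positivity
          have e4 : 4 * b * (M + (k + 1) * v) * R =
            4 * (b * M * R) + 4 * (k * (b * v * R)) + 4 * (b * v * R) := by ring
          linarith

lemma weight_convPow {F : Measure ℝ} [IsProbabilityMeasure F]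
    (c : ExpansionControl (tail F) h W m t₁ A) (hF : F (Set.Iio 0) = 0) (hWF : Integrable W F)
    (n : ℕ) : Integrable W (convPow F n) ∧
      ∫ x, W x ∂(convPow F n) ≤ W 0 * (A * ∫ x, W x ∂F) ^ n := by
  induction n with
  | zero =>
    refine ⟨integrable_dirac' c.measurable_weight.stronglyMeasurable (by simp), ?_⟩
    rw [convPow, integral_dirac' _ _ c.measurable_weight.stronglyMeasurable]
    simp
  | succ n ih =>
    obtain ⟨h1, h2⟩ := c.weight_conv (convPow_Iio_zero hF n) hF ih.1 hWF
    refine ⟨h1, h2.trans ?_⟩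
    have hA := c.one_le_const
    have hw := c.one_le_integral_weight hWF
    calc A * ((∫ x, W x ∂(convPow F n)) * ∫ x, W x ∂F)
        ≤ A * (W 0 * (A * ∫ x, W x ∂F) ^ n * ∫ x, W x ∂F) := by gcongr; exact ih.2
      _ = _ := by rw [pow_succ]; ring

lemma laplaceApply_dirac_zero (m : ℕ) (T : ℝ → ℝ) (t : ℝ) :
    laplaceApply (Measure.dirac 0) m T t = T t := by
  rw [laplaceApply, Finset.sum_range_succ']
  simp [laplaceCoeff, moment_id_eq]

/-- Uniform expansion of the tails of the convolution powers of `F`. -/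
theorem exists_abs_tail_convPow_sub_le {F : Measure ℝ} [IsProbabilityMeasure F]
    (c : ExpansionControl (tail F) h W m t₁ A) (hF : F (Set.Iio 0) = 0) (hWF : Integrable W F) :
    ∃ D : ℝ, 1 ≤ D ∧ ∀ n : ℕ, ∫ x, W x ∂(convPow F n) ≤ D ^ (n + 1) ∧ ∀ t, t₁ ≤ t →
      |tail (convPow F (n + 1)) t - (n + 1) * laplaceApply (convPow F n) m (tail F) t| ≤
        D ^ (n + 1) * (h t ^ (m + 1) * tail F t) := by
  have hA := c.one_le_const
  have hw := c.one_le_integral_weight hWF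
  have hW0 := c.one_le_weight 0
  set w := ∫ x, W x ∂F
  set b : ℝ := 4 * ((m + 1) * (A * A * A * A) * w) with hb
  have hb0 : 0 < b := by positivity
  have hB : 1 ≤ A * w := one_le_mul_of_one_le_of_one_le hA hw
  set B := A * w
  -- `2 * B` absorbs the factor `n + 2 ≤ 2^(n+1)` together with the weight integral. `2 * b * W 0`
  -- ensures `b + b * W 0 ≤ D` in the induction step. `W 0` is the weight integral of the Dirac
  -- mass.
  set D := 2 * b * W 0 + 2 * B + W 0 with hD
  have hbW : 0 < b * W 0 := by positivity
  have hDB : 2 * B ≤ D := by linarith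
  have hDW : W 0 ≤ D := by linarith
  have hDb : 2 * b ≤ D := by nlinarith
  have hDbW : 2 * (b * W 0) ≤ D := by linarith
  have hD1 : 1 ≤ D := by linarith
  have hweight : ∀ n : ℕ, ∫ x, W x ∂(convPow F n) ≤ D ^ (n + 1) := fun n => by
    refine (c.weight_convPow hF hWF n).2.trans ?_
    rw [pow_succ']
    have : B ≤ D := by linarith
    gcongr
  refine ⟨D, hD1, fun n => ⟨hweight n, ?_⟩⟩
  induction n with
  | zero =>
    intro t ht
    have hR := c.rate_pos ht
    -- For `n = 0` the expansion is exact, since the character of the Dirac mass at 0 acts as the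
    -- identity.
    have h1 : convPow F 1 = F := by
      change (Measure.dirac 0).conv F = F
      exact Measure.dirac_zero_conv F
    rw [zero_add, h1, convPow, laplaceApply_dirac_zero]
    simp only [CharP.cast_eq_zero, zero_add, one_mul, sub_self, abs_zero, pow_one]
    positivity
  | succ n ih =>
    intro t ht
    have hR := c.rate_pos ht
    have h1 := c.abs_tail_conv_sub_le hF hWF (convPow_Iio_zero hF n) (c.weight_convPow hF hWF n).1
      (k := n + 1) (M := D ^ (n + 1)) (by positivity) (by positivity) ih ht
    rw [Nat.cast_succ]
    refine h1.trans ?_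
    have hn : (n : ℝ) + 1 + 1 ≤ 2 ^ (n + 1) := by
      have : n + 1 + 1 ≤ 2 ^ (n + 1) := Nat.lt_two_pow_self
      exact_mod_cast this
    have hv0 : 0 ≤ ∫ x, W x ∂(convPow F n) := by
      have := c.one_le_integral_weight (c.weight_convPow hF hWF n).1
      linarith
    have h2 : ((n : ℝ) + 1 + 1) * ∫ x, W x ∂(convPow F n) ≤ W 0 * D ^ (n + 1) := by
      calc ((n : ℝ) + 1 + 1) * ∫ x, W x ∂(convPow F n)
          ≤ 2 ^ (n + 1) * (W 0 * B ^ n) := by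
            gcongr
            exact (c.weight_convPow hF hWF n).2
        _ ≤ 2 ^ (n + 1) * (W 0 * B ^ (n + 1)) := by
            gcongr
            exact Nat.le_succ n
        _ = W 0 * (2 * B) ^ (n + 1) := by rw [mul_pow]; ring
        _ ≤ W 0 * D ^ (n + 1) := by gcongr
    have hDn : 0 < D ^ (n + 1) := by positivity
    have h3 : b * (D ^ (n + 1) + ((n : ℝ) + 1 + 1) * ∫ x, W x ∂(convPow F n)) ≤
        D ^ (n + 1 + 1) := by
      calc b * (D ^ (n + 1) + ((n : ℝ) + 1 + 1) * ∫ x, W x ∂(convPow F n))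
          ≤ b * (D ^ (n + 1) + W 0 * D ^ (n + 1)) := by gcongr
        _ = (b + b * W 0) * D ^ (n + 1) := by ring
        _ ≤ D * D ^ (n + 1) := by gcongr; linarith
        _ = _ := by rw [pow_succ' D (n + 1)]
    exact mul_le_mul_of_nonneg_right h3 hR.le

end ExpansionControl

/-! ### Poisson mixtures of convolution powers -/

noncomputable section

/-- The mass at `n` of the Poisson distribution with parameter `a`. -/
def poissonWeight (a : ℝ≥0) (n : ℕ) : ℝ := Real.exp (-a) * a ^ n / n.factorial

lemma poissonWeight_nonneg (a : ℝ≥0) (n : ℕ) : 0 ≤ poissonWeight a n := by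
  unfold poissonWeight; positivity

lemma hasSum_poissonWeight (a : ℝ≥0) : HasSum (poissonWeight a) 1 := hasSum_one_poissonMeasure a

/-- Turns the factor `n + 1` of the expansion and the shift from `n + 1` to `n` into the single
factor `a` in front of `L_G`. -/
lemma poissonWeight_succ (a : ℝ≥0) (n : ℕ) :
    poissonWeight a (n + 1) * (n + 1) = poissonWeight a n * a := by
  unfold poissonWeight
  rw [Nat.factorial_succ]
  push_cast
  field_simp
  ring

lemma summable_poissonWeight_mul_pow (a : ℝ≥0) (D : ℝ) :
    Summable fun n => poissonWeight a n * D ^ n := by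
  have := (Real.summable_pow_div_factorial (a * D)).mul_left (Real.exp (-a))
  refine this.congr fun n => ?_
  unfold poissonWeight
  rw [mul_pow]; ring

/-- Factorial moments of the Poisson distribution. -/
lemma hasSum_poissonWeight_mul_choose (a : ℝ≥0) (k : ℕ) :
    HasSum (fun n => poissonWeight a n * (n.choose k : ℝ)) ((a : ℝ) ^ k / k.factorial) := by
  rw [← hasSum_nat_add_iff' k]
  have h0 : ∑ i ∈ Finset.range k, poissonWeight a i * (i.choose k : ℝ) = 0 :=
    Finset.sum_eq_zero fun i hi => by
      rw [Nat.choose_eq_zero_of_lt (Finset.mem_range.1 hi)]; simp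
  rw [h0, sub_zero]
  have := (hasSum_poissonWeight a).mul_left ((a : ℝ) ^ k / k.factorial)
  rw [mul_one] at this
  refine this.congr_fun fun n => ?_
  unfold poissonWeight
  rw [Nat.cast_choose ℝ (Nat.le_add_left k n), Nat.add_sub_cancel, pow_add]
  have := Nat.factorial_ne_zero (n + k)
  field_simp

/-- The compound Poisson distribution as a mixture of convolution powers. -/
def compoundPoisson (F : Measure ℝ) (a : ℝ≥0) : Measure ℝ :=
  Measure.sum fun n => ENNReal.ofReal (poissonWeight a n) • convPow F n

section Law

variable {Ω : Type*} [MeasurableSpace Ω] {P : Measure Ω} [IsProbabilityMeasure P]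
  {F : Measure ℝ} {X : ℕ → Ω → ℝ} {N : Ω → ℕ} {a : ℝ≥0}

lemma map_sum_range_eq_convPow (hX_meas : ∀ i, Measurable (X i)) (hX_law : ∀ i, P.map (X i) = F)
    (hX_indep : iIndepFun X P) (n : ℕ) :
    P.map (fun ω => ∑ i ∈ Finset.range n, X i ω) = convPow F n := by
  induction n with
  | zero => simp [convPow]
  | succ n ih =>
    have hind : IndepFun (∑ i ∈ Finset.range n, X i) (X n) P :=
      hX_indep.indepFun_sum_range_succ hX_meas n
    have hfun : (∑ i ∈ Finset.range n, X i) = fun ω => ∑ i ∈ Finset.range n, X i ω := by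
      funext ω; simp
    have hm : Measurable fun ω => ∑ i ∈ Finset.range n, X i ω :=
      Finset.measurable_fun_sum _ fun i _ => hX_meas i
    rw [hfun] at hind
    rw [convPow, ← ih, ← hX_law n, ← hind.map_add_eq_map_conv_map hm (hX_meas n)]
    congr 1
    funext ω
    simp [Finset.sum_range_succ]

lemma measurable_compoundSum (hX_meas : ∀ i, Measurable (X i)) (hN_meas : Measurable N) :
    Measurable (compoundSum N X) := by
  have h1 : Measurable fun p : ℕ × Ω => ∑ i ∈ Finset.range p.1, X i p.2 :=
    measurable_from_prod_countable_right fun n =>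
      Finset.measurable_fun_sum (Finset.range n) fun i _ => hX_meas i
  exact h1.comp (hN_meas.prodMk measurable_id)

lemma map_compoundSum (hX_meas : ∀ i, Measurable (X i)) (hX_law : ∀ i, P.map (X i) = F)
    (hX_indep : iIndepFun X P) (hN_meas : Measurable N) (hN_law : P.map N = poissonMeasure a)
    (hN_indep : IndepFun N (fun ω i => X i ω) P) :
    P.map (compoundSum N X) = compoundPoisson F a := by
  ext A hA
  have hSm : ∀ n, Measurable fun ω => ∑ i ∈ Finset.range n, X i ω := fun n =>
    Finset.measurable_fun_sum _ fun i _ => hX_meas i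
  have hpre : compoundSum N X ⁻¹' A =
      ⋃ n, N ⁻¹' {n} ∩ (fun ω => ∑ i ∈ Finset.range n, X i ω) ⁻¹' A := by
    ext ω
    simp [compoundSum]
  rw [Measure.map_apply (measurable_compoundSum hX_meas hN_meas) hA, hpre, measure_iUnion
    (fun i j hij => Set.disjoint_left.2 fun ω h1 h2 => hij (h1.1.symm.trans h2.1))
    (fun n => (hN_meas (measurableSet_singleton n)).inter (hSm n hA)),
    compoundPoisson, Measure.sum_apply _ hA]
  refine tsum_congr fun n => ?_
  have hind : IndepFun N (fun ω => ∑ i ∈ Finset.range n, X i ω) P :=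
    hN_indep.comp measurable_id (ψ := fun f : ℕ → ℝ => ∑ i ∈ Finset.range n, f i)
      (Finset.measurable_fun_sum _ fun i _ => measurable_pi_apply i)
  rw [hind.measure_inter_preimage_eq_mul _ _ (measurableSet_singleton n) hA,
    ← Measure.map_apply hN_meas (measurableSet_singleton n), ← Measure.map_apply (hSm n) hA, hN_law,
    map_sum_range_eq_convPow hX_meas hX_law hX_indep n, poissonMeasure_singleton,
    Measure.smul_apply, smul_eq_mul, poissonWeight]

end Law

lemma hasSum_integral_compoundPoisson {F : Measure ℝ} {a : ℝ≥0} {f : ℝ → ℝ}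
    (hf : ∀ n, Integrable f (convPow F n))
    (hs : Summable fun n => poissonWeight a n * ∫ x, |f x| ∂(convPow F n)) :
    Integrable f (compoundPoisson F a) ∧
      HasSum (fun n => poissonWeight a n * ∫ x, f x ∂(convPow F n))
        (∫ x, f x ∂(compoundPoisson F a)) := by
  have hi : Integrable f (compoundPoisson F a) := by
    refine integrable_sum_measure (fun n => (hf n).smul_measure ENNReal.ofReal_ne_top) ?_
    refine hs.congr fun n => ?_
    rw [integral_smul_measure, ENNReal.toReal_ofReal (poissonWeight_nonneg a n)]
    rfl
  refine ⟨hi, (hasSum_integral_measure hi).congr_fun fun n => ?_⟩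
  rw [integral_smul_measure, ENNReal.toReal_ofReal (poissonWeight_nonneg a n)]
  rfl

lemma hasSum_tail_compoundPoisson {F : Measure ℝ} [IsProbabilityMeasure F] {a : ℝ≥0}
    [IsProbabilityMeasure (compoundPoisson F a)] (t : ℝ) :
    HasSum (fun n => poissonWeight a n * tail (convPow F n) t) (tail (compoundPoisson F a) t) := by
  have hi : ∀ n, Integrable ((Set.Ioi t).indicator fun _ => (1 : ℝ)) (convPow F n) := fun n =>
    (integrable_const 1).indicator measurableSet_Ioi
  have he : ∀ (μ : Measure ℝ) [IsProbabilityMeasure μ],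
      ∫ x, (Set.Ioi t).indicator (fun _ => (1 : ℝ)) x ∂μ = tail μ t := fun μ _ => by
    rw [integral_indicator measurableSet_Ioi, tail_eq_real]; simp
  have := (hasSum_integral_compoundPoisson (a := a) hi ?_).2
  · simpa only [he] using this
  · refine (hasSum_poissonWeight a).summable.of_nonneg_of_le (fun n => ?_) fun n => ?_
    · exact mul_nonneg (poissonWeight_nonneg a n) (integral_nonneg fun x => abs_nonneg _)
    · refine mul_le_of_le_one_right (poissonWeight_nonneg a n) ?_
      have h1 : ∀ x, |(Set.Ioi t).indicator (fun _ => (1 : ℝ)) x| =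
          (Set.Ioi t).indicator (fun _ => (1 : ℝ)) x := fun x =>
        abs_of_nonneg (Set.indicator_nonneg (fun _ _ => zero_le_one) x)
      simp only [h1, he]
      exact tail_le_one _ _

/-- The assertions on the compound distribution that rely on the growth of the moments of the
convolution powers. -/
lemma hasSum_moment_compoundPoisson {F : Measure ℝ} {a : ℝ≥0}
    {i : ℕ} {B D : ℝ} (hint : ∀ n, Integrable (fun x : ℝ => x ^ i) (convPow F n))
    (hB : ∀ n, ∫ x, |x ^ i| ∂(convPow F n) ≤ B * D ^ n) :
    Integrable (fun x : ℝ => x ^ i) (compoundPoisson F a) ∧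
      HasSum (fun n => poissonWeight a n * laplaceCoeff (convPow F n) i)
        (laplaceCoeff (compoundPoisson F a) i) := by
  have h1 := hasSum_integral_compoundPoisson (a := a) hint ?_
  · refine ⟨h1.1, (h1.2.mul_left ((-1) ^ i / (i.factorial : ℝ))).congr_fun fun n => ?_⟩
    rw [laplaceCoeff, moment_id_eq]; ring
  · refine ((summable_poissonWeight_mul_pow a D).mul_left B).of_nonneg_of_le (fun n => ?_)
      fun n => ?_
    · exact mul_nonneg (poissonWeight_nonneg a n) (integral_nonneg fun x => abs_nonneg _)
    · calc poissonWeight a n * ∫ x, |x ^ i| ∂(convPow F n)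
          ≤ poissonWeight a n * (B * D ^ n) :=
            mul_le_mul_of_nonneg_left (hB n) (poissonWeight_nonneg a n)
        _ = _ := by ring

/-- The tail of the compound distribution differs from its expansion by `O(h ^ (m + 1) * T)`. -/
lemma abs_tail_compoundPoisson_sub_le {F : Measure ℝ} [IsProbabilityMeasure F] {a : ℝ≥0}
    [IsProbabilityMeasure (compoundPoisson F a)] {m : ℕ} {D R t : ℝ} (ht : 0 ≤ t)
    (hmom : ∀ i ≤ m, HasSum (fun n => poissonWeight a n * laplaceCoeff (convPow F n) i)
      (laplaceCoeff (compoundPoisson F a) i))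
    (hE : ∀ n : ℕ, |tail (convPow F (n + 1)) t -
      (n + 1) * laplaceApply (convPow F n) m (tail F) t| ≤ D ^ (n + 1) * R) :
    |tail (compoundPoisson F a) t - a * laplaceApply (compoundPoisson F a) m (tail F) t| ≤
      (∑' n, poissonWeight a (n + 1) * D ^ (n + 1)) * R := by
  -- The term `n = 0` drops out because `S_0 = 0` does not exceed `t ≥ 0`.
  have h1 := (hasSum_nat_add_iff' 1).2 (hasSum_tail_compoundPoisson (F := F) (a := a) t)
  have h0 : tail (convPow F 0) t = 0 := by
    rw [convPow, tail_eq_real, measureReal_def, Measure.dirac_apply' _ measurableSet_Ioi]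
    simp [ht]
  rw [Finset.sum_range_one, h0, mul_zero, sub_zero] at h1
  have h2 : HasSum (fun n => poissonWeight a n * laplaceApply (convPow F n) m (tail F) t)
      (laplaceApply (compoundPoisson F a) m (tail F) t) := by
    have := hasSum_sum fun i (hi : i ∈ Finset.range (m + 1)) =>
      (hmom i (Finset.mem_range_succ_iff.1 hi)).mul_right (iteratedDeriv i (tail F) t)
    refine this.congr_fun fun n => ?_
    rw [laplaceApply, Finset.mul_sum]
    exact Finset.sum_congr rfl fun i _ => by ring
  have h3 := h1.sub (h2.mul_left (a : ℝ))
  have h4 := ((summable_nat_add_iff 1).2 (summable_poissonWeight_mul_pow a D)).hasSum.mul_right R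
  refine h3.norm_le_of_bounded h4 fun n => ?_
  have h5 : poissonWeight a (n + 1) * tail (convPow F (n + 1)) t -
      a * (poissonWeight a n * laplaceApply (convPow F n) m (tail F) t) =
      poissonWeight a (n + 1) * (tail (convPow F (n + 1)) t -
        (n + 1) * laplaceApply (convPow F n) m (tail F) t) := by
    have := poissonWeight_succ a n
    linear_combination (laplaceApply (convPow F n) m (tail F) t) * this
  rw [h5, Real.norm_eq_abs, abs_mul, abs_of_nonneg (poissonWeight_nonneg a _), mul_assoc]
  exact mul_le_mul_of_nonneg_left (hE n) (poissonWeight_nonneg a _)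

/-! ### Laplace characters in the truncated ring -/

lemma coeff_laplaceCharacter (F : Measure ℝ) (m i : ℕ) :
    (laplaceCharacter F m).coeff i = if i ≤ m then laplaceCoeff F i else 0 := by
  simp only [laplaceCharacter, finsetSum_coeff, coeff_C_mul, coeff_X_pow, mul_ite, mul_one,
    mul_zero, Finset.sum_ite_eq, Finset.mem_range_succ_iff]
  rfl

lemma applyDiffOp_laplaceCharacter (H : Measure ℝ) (m : ℕ) (T : ℝ → ℝ) (t : ℝ) :
    applyDiffOp (laplaceCharacter H m) T t = laplaceApply H m T t := by
  have hdeg : (laplaceCharacter H m).natDegree ≤ m :=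
    natDegree_le_iff_coeff_eq_zero.2 fun i hi => by
      rw [coeff_laplaceCharacter, if_neg (by omega)]
  rw [applyDiffOp, laplaceApply, Finset.sum_subset (Finset.range_mono (Nat.succ_le_succ hdeg))]
  · refine Finset.sum_congr rfl fun i hi => ?_
    rw [coeff_laplaceCharacter, if_pos (Finset.mem_range_succ_iff.1 hi)]
  · intro i _ hi
    rw [coeff_eq_zero_of_natDegree_lt (by simpa [Finset.mem_range, Nat.lt_succ_iff] using hi),
      zero_mul]

lemma toTruncatedRing_eq_iff {m : ℕ} {p r : ℝ[X]} :
    toTruncatedRing m p = toTruncatedRing m r ↔ ∀ k ≤ m, p.coeff k = r.coeff k := by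
  rw [toTruncatedRing, toTruncatedRing, Ideal.Quotient.mk_eq_mk_iff_sub_mem,
    Ideal.mem_span_singleton, X_pow_dvd_iff]
  simp only [coeff_sub, sub_eq_zero, Nat.lt_succ_iff]

lemma coeff_zero_laplaceCharacter_sub_one (F : Measure ℝ) [IsProbabilityMeasure F] (m : ℕ) :
    (laplaceCharacter F m - 1).coeff 0 = 0 := by
  simp [coeff_laplaceCharacter, laplaceCoeff, moment_id_eq]

lemma coeff_pow_eq_zero_of_lt {p : ℝ[X]} (hp : p.coeff 0 = 0) {j k : ℕ} (hjk : j < k) :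
    (p ^ k).coeff j = 0 :=
  X_pow_dvd_iff.1 (pow_dvd_pow_of_dvd (X_dvd_iff.2 hp) k) j hjk

/-- `F` has mass one, so `X` divides `L_F - 1` and `X^(m+1)` divides its power. -/
lemma pow_succ_laplaceCharacter_sub_one (F : Measure ℝ) [IsProbabilityMeasure F] (m : ℕ) :
    (toTruncatedRing m (laplaceCharacter F m) - 1) ^ (m + 1) = 0 := by
  have h1 : (toTruncatedRing m (laplaceCharacter F m) - 1) ^ (m + 1) =
      toTruncatedRing m ((laplaceCharacter F m - 1) ^ (m + 1)) := by
    simp only [toTruncatedRing, map_pow, map_sub, map_one]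
  rw [h1, show (0 : TruncatedRing m) = toTruncatedRing m 0 from (map_zero _).symm,
    toTruncatedRing_eq_iff]
  intro k hk
  rw [coeff_pow_eq_zero_of_lt (coeff_zero_laplaceCharacter_sub_one F m) (by omega), coeff_zero]

/-- The equality is in the quotient: powers of the polynomial may have terms beyond degree `m`,
which the character of the convolution power lacks. -/
lemma laplaceCharacter_convPow {F : Measure ℝ} [IsProbabilityMeasure F] {m : ℕ}
    (hint : ∀ n, ∀ i ≤ m, Integrable (fun x : ℝ => x ^ i) (convPow F n))
    (hF : ∀ i ≤ m, Integrable (fun x : ℝ => x ^ i) F) (n : ℕ) :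
    toTruncatedRing m (laplaceCharacter (convPow F n) m) =
      toTruncatedRing m (laplaceCharacter F m ^ n) := by
  induction n with
  | zero =>
    rw [toTruncatedRing_eq_iff]
    intro k hk
    rw [coeff_laplaceCharacter, if_pos hk, pow_zero, coeff_one, laplaceCoeff, moment_id_eq, convPow,
      integral_dirac]
    rcases k with _ | k <;> simp
  | succ n ih =>
    have h1 : toTruncatedRing m (laplaceCharacter (convPow F (n + 1)) m) =
        toTruncatedRing m (laplaceCharacter (convPow F n) m * laplaceCharacter F m) := by
      rw [toTruncatedRing_eq_iff]
      intro k hk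
      rw [coeff_laplaceCharacter, if_pos hk, convPow, laplaceCoeff_conv
        (fun i hi => hint n i (hi.trans hk)) (fun i hi => hF i (hi.trans hk)), coeff_mul,
        Finset.Nat.sum_antidiagonal_eq_sum_range_succ_mk]
      refine Finset.sum_congr rfl fun i hi => ?_
      have := Finset.mem_range_succ_iff.1 hi
      rw [coeff_laplaceCharacter, coeff_laplaceCharacter, if_pos (by omega), if_pos (by omega)]
    have h2 : ∀ p r : ℝ[X], toTruncatedRing m (p * r) = toTruncatedRing m p * toTruncatedRing m r :=
      fun p r => map_mul _ p r
    rw [h1, h2, ih, ← h2, pow_succ (laplaceCharacter F m) n]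

/-- Terms with `k > j` vanish because `X` divides `p - 1`. The range of summation thus becomes
independent of `n`, so a Poisson average over `n` can be taken term by term. -/
lemma coeff_pow_eq_sum_choose {p : ℝ[X]} (hp : (p - 1).coeff 0 = 0) {j m : ℕ} (hj : j ≤ m)
    (n : ℕ) :
    (p ^ n).coeff j = ∑ k ∈ Finset.range (m + 1), (n.choose k : ℝ) * ((p - 1) ^ k).coeff j := by
  have h1 : p ^ n = ∑ k ∈ Finset.range (n + 1), (p - 1) ^ k * (n.choose k : ℝ[X]) := by
    conv_lhs => rw [show p = (p - 1) + 1 by ring, add_pow]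
    simp
  have h2 : (p ^ n).coeff j =
      ∑ k ∈ Finset.range (n + 1), (n.choose k : ℝ) * ((p - 1) ^ k).coeff j := by
    rw [h1, finsetSum_coeff]
    refine Finset.sum_congr rfl fun k _ => ?_
    rw [coeff_mul_natCast, mul_comm]
  rw [h2]
  have h3 : ∀ N, n ≤ N → m ≤ N →
      (∑ k ∈ Finset.range (n + 1), (n.choose k : ℝ) * ((p - 1) ^ k).coeff j =
        ∑ k ∈ Finset.range (N + 1), (n.choose k : ℝ) * ((p - 1) ^ k).coeff j) ∧
      (∑ k ∈ Finset.range (m + 1), (n.choose k : ℝ) * ((p - 1) ^ k).coeff j =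
        ∑ k ∈ Finset.range (N + 1), (n.choose k : ℝ) * ((p - 1) ^ k).coeff j) := by
    intro N hn hm
    refine ⟨Finset.sum_subset (Finset.range_mono (by omega)) fun k _ hk => ?_,
      Finset.sum_subset (Finset.range_mono (by omega)) fun k _ hk => ?_⟩
    · rw [Nat.choose_eq_zero_of_lt (by simpa [Nat.lt_succ_iff] using hk)]; simp
    · rw [coeff_pow_eq_zero_of_lt hp (by simp at hk; omega), mul_zero]
  obtain ⟨e1, e2⟩ := h3 (max n m) (le_max_left _ _) (le_max_right _ _)
  rw [e1, e2]

/-- The Laplace character of a compound Poisson distribution is an exponential. -/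
theorem laplaceCharacter_compoundPoisson {F : Measure ℝ} [IsProbabilityMeasure F] {m : ℕ}
    {a : ℝ≥0} (hint : ∀ n, ∀ i ≤ m, Integrable (fun x : ℝ => x ^ i) (convPow F n))
    (hF : ∀ i ≤ m, Integrable (fun x : ℝ => x ^ i) F)
    (hmom : ∀ i ≤ m, HasSum (fun n => poissonWeight a n * laplaceCoeff (convPow F n) i)
      (laplaceCoeff (compoundPoisson F a) i)) :
    toTruncatedRing m (laplaceCharacter (compoundPoisson F a) m) =
      IsNilpotent.exp ((a : ℝ) • (toTruncatedRing m (laplaceCharacter F m) - 1)) := by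
  have hpow : ((a : ℝ) • (toTruncatedRing m (laplaceCharacter F m) - 1)) ^ (m + 1) = 0 := by
    rw [_root_.smul_pow, pow_succ_laplaceCharacter_sub_one, smul_zero]
  have hexp : IsNilpotent.exp ((a : ℝ) • (toTruncatedRing m (laplaceCharacter F m) - 1)) =
      toTruncatedRing m (∑ k ∈ Finset.range (m + 1),
        ((a : ℝ) ^ k / k.factorial) • (laplaceCharacter F m - 1) ^ k) := by
    rw [IsNilpotent.exp_eq_sum hpow]
    refine Eq.trans ?_ (map_sum (Ideal.Quotient.mk (Ideal.span {(X : ℝ[X]) ^ (m + 1)})) _ _).symm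
    refine Finset.sum_congr rfl fun k _ => ?_
    -- `IsNilpotent.exp` has rational coefficients, recast here as real ones.
    rw [_root_.smul_pow, ← Rat.cast_smul_eq_qsmul ℝ, smul_smul]
    have : ∀ (r : ℝ) (p : ℝ[X]), (Ideal.Quotient.mk (Ideal.span {(X : ℝ[X]) ^ (m + 1)})) (r • p) =
        r • (Ideal.Quotient.mk (Ideal.span {(X : ℝ[X]) ^ (m + 1)})) p := fun r p => rfl
    rw [this, map_pow, map_sub, map_one]
    congr 1
    push_cast
    rw [div_eq_inv_mul]
  rw [hexp, toTruncatedRing_eq_iff]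
  intro j hj
  rw [coeff_laplaceCharacter, if_pos hj, finsetSum_coeff]
  have hc := coeff_zero_laplaceCharacter_sub_one F m
  have h1 : ∀ n, poissonWeight a n * laplaceCoeff (convPow F n) j =
      ∑ k ∈ Finset.range (m + 1), poissonWeight a n * (n.choose k : ℝ) *
        ((laplaceCharacter F m - 1) ^ k).coeff j := by
    intro n
    have := toTruncatedRing_eq_iff.1 (laplaceCharacter_convPow hint hF n) j hj
    rw [coeff_laplaceCharacter, if_pos hj] at this
    rw [this, coeff_pow_eq_sum_choose hc hj n, Finset.mul_sum]
    exact Finset.sum_congr rfl fun k _ => by ring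
  -- Averaging `n.choose k` gives `a^k / k!`, the coefficient of the exponential; both series then
  -- have the same sum.
  have h2 := hasSum_sum fun k (_ : k ∈ Finset.range (m + 1)) =>
    (hasSum_poissonWeight_mul_choose a k).mul_right (((laplaceCharacter F m - 1) ^ k).coeff j)
  refine (hmom j hj).unique ?_
  simp only [h1, coeff_smul, smul_eq_mul]
  exact h2

end

end CompoundSum

/-! ### The proposition -/

theorem proposition3p1
    {Ω : Type*} [MeasurableSpace Ω] (P : Measure Ω) [IsProbabilityMeasure P]
    (F : Measure ℝ) [IsProbabilityMeasure F]
    (X : ℕ → Ω → ℝ) (N : Ω → ℕ) (a : ℝ≥0) (m : ℕ) (ρ : ℝ)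
    -- the summands are nonnegative, independent, and have distribution `F`
    (hX_meas : ∀ i, Measurable (X i))
    (hX_law : ∀ i, P.map (X i) = F)
    (hX_indep : iIndepFun X P)
    (hF_nonneg : F (Set.Iio 0) = 0)
    -- `N` is Poisson with parameter `a` and independent of the summands
    (hN_meas : Measurable N)
    (hN_law : P.map N = poissonMeasure a)
    (hN_indep : IndepFun N (fun ω i => X i ω) P)
    -- assumptions on the hazard rate
    (hm : 1 ≤ m) (hρ_ge : -1 ≤ ρ) (hρ_neg : ρ < 0)
    (h_smooth : IsSmoothlyVarying (hazardRate F) ρ m)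
    (h_zero : Tendsto (hazardRate F) atTop (𝓝 0))
    (h_liminf : 0 < liminf (fun t : ℝ => ((t * hazardRate F t / Real.log t : ℝ) : EReal)) atTop) :
    HasMoments F m ∧ HasMoments (P.map (compoundSum N X)) m ∧
    ((fun t => tail (P.map (compoundSum N X)) t -
        (a : ℝ) * applyDiffOp (laplaceCharacter (P.map (compoundSum N X)) m) (tail F) t)
      =o[atTop] fun t => hazardRate F t ^ m * tail F t) ∧
    IsNilpotent ((a : ℝ) • (toTruncatedRing m (laplaceCharacter F m) - 1)) ∧
    toTruncatedRing m (laplaceCharacter (P.map (compoundSum N X)) m) =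
      IsNilpotent.exp ((a : ℝ) • (toTruncatedRing m (laplaceCharacter F m) - 1)) := by
  obtain ⟨t₁, q, K, c₀⟩ := exists_tailControl hm hρ_neg h_smooth h_zero h_liminf
  obtain ⟨A, c⟩ := c₀.exists_expansionControl
  have hWF := c₀.integrable_rpow_neg (s := (1 + q) / 2) (by linarith [c₀.q_pos])
    (by linarith [c₀.q_lt_one])
  obtain ⟨D, -, hD⟩ := c.exists_abs_tail_convPow_sub_le hF_nonneg hWF
  have hA : 0 ≤ A := by linarith [c.one_le_const]
  have hlaw := map_compoundSum hX_meas hX_law hX_indep hN_meas hN_law hN_indep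
  have hG : IsProbabilityMeasure (compoundPoisson F a) := by
    rw [← hlaw]
    exact Measure.isProbabilityMeasure_map (measurable_compoundSum hX_meas hN_meas).aemeasurable
  have hF_int : ∀ i ≤ m, Integrable (fun x : ℝ => x ^ i) F := fun i hi =>
    c.integrable_pow hF_nonneg hWF hi
  have hint : ∀ n, ∀ i ≤ m, Integrable (fun x : ℝ => x ^ i) (convPow F n) := fun n i hi =>
    c.integrable_pow (convPow_Iio_zero hF_nonneg n) (c.weight_convPow hF_nonneg hWF n).1 hi
  have hmom := fun i (hi : i ≤ m) => hasSum_moment_compoundPoisson (a := a) (B := A * D) (D := D)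
    (fun n => hint n i hi) fun n => by
      refine (c.integral_abs_pow_le (convPow_Iio_zero hF_nonneg n)
        (c.weight_convPow hF_nonneg hWF n).1 hi).trans ?_
      rw [mul_assoc, ← pow_succ']
      exact mul_le_mul_of_nonneg_left (hD n).1 hA
  rw [hlaw]
  refine ⟨hF_int, fun i hi => (hmom i hi).1, ?_, ⟨m + 1, ?_⟩,
    laplaceCharacter_compoundPoisson hint hF_int fun i hi => (hmom i hi).2⟩
  · simp only [applyDiffOp_laplaceCharacter]
    have hO : (fun t => tail (compoundPoisson F a) t -
        (a : ℝ) * laplaceApply (compoundPoisson F a) m (tail F) t) =O[atTop]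
        fun t => hazardRate F t * (hazardRate F t ^ m * tail F t) := by
      refine IsBigO.of_bound (∑' n, poissonWeight a (n + 1) * D ^ (n + 1)) ?_
      filter_upwards [eventually_ge_atTop t₁] with t ht
      have h1 := abs_tail_compoundPoisson_sub_le (by linarith [c.one_le])
        (fun i hi => (hmom i hi).2) fun n => (hD n).2 t ht
      have h2 := c.rate_pos ht
      rw [← mul_assoc, ← pow_succ', Real.norm_eq_abs, Real.norm_eq_abs, abs_of_pos h2]
      exact h1
    -- The error bound has one extra factor `h`, which tends to 0.
    refine hO.trans_isLittleO ?_
    have h1 : (hazardRate F) =o[atTop] fun _ => (1 : ℝ) := (isLittleO_one_iff ℝ).2 h_zero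
    simpa using h1.mul_isBigO
      (isBigO_refl (fun t => hazardRate F t ^ m * tail F t) atTop)
  · rw [_root_.smul_pow, pow_succ_laplaceCharacter_sub_one, smul_zero]
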